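/- Let $c\in\mathbb C\setminus\{0\}$, $g(u,v)=\frac{c}{u-v}$, $f(u,v)=1+g(u,v)$, $h(u,v)=\frac{f(u,v)}{g(u,v)}=\frac{u-v+c}{c}$, and for an ordered tuple $\bar v=(v_1,\dots,v_b)$ put $H(\bar v)=\prod_{1\le k<j\le b}h(v_j,v_k)$. Grade $\mathbb C^{2|1}$ by $[1]=[2]=0$, $[3]=1$, and let $Y(2|1)$ be the unital associative algebra generated by the modes $T^{(p)}_{ij}$ ($1\le i,j\le 3$, $p\ge 0$) of $T_{ij}(u)=\delta_{ij}+\sum_{p\ge0}T_{ij}^{(p)}(c/u)^{p+1}$, with the RTT relations $$T_{ij}(z)T_{kl}(w)-(-1)^{([i]+[j])([k]+[l])}T_{kl}(w)T_{ij}(z)=(-1)^{[l]([i]+[j])+[i][j]}g(z,w)\bigl(T_{il}(z)T_{kj}(w)-T_{il}(w)T_{kj}(z)\bigr).\qquad(\ast)$$ Let $\Omega$ be a singular vector of a representation: $T_{ii}(u)\Omega=\lambda_i(u)\Omega$ for all $i$, and $T_{ij}(u)\Omega=0$ for $i>j$. For ordered tuples $\bar u=(u_1,\dots,u_a)$, $\bar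 v=(v_1,\dots,v_b)$ the Bethe vector is $$\Phi_{a,b}(\bar u,\bar v)=\frac{(-1)^b}{H(\bar v)}\,\mathrm{str}_{1\cdots a+b}\Bigl[T_1(u_1)\cdots T_a(u_a)\,T_{a+1}(v_1)\cdots T_{a+b}(v_b)\,\mathbb R\;E_{21}^{(1)}\cdots E_{21}^{(a)}E_{32}^{(a+1)}\cdots E_{32}^{(a+b)}\Bigr]\Omega,$$ where the super-trace is over $a+b$ copies of $\mathbb C^{2|1}$, $T_p(u)=\sum_{ij}E^{(p)}_{ij}\otimes T_{ij}(u)$, all tensor products are graded (with $T_{ij}$ of parity $[i]+[j]$), and $\mathbb R=(R_{a+1,a}\cdots R_{a+1,1})\cdots(R_{a+b,a}\cdots R_{a+b,1})$ with $R_{a+j,k}=1+g(v_j,u_k)P_{a+j,k}$ and $P_{pq}=\sum_{ij}(-1)^{[j]}E^{(p)}_{ij}E^{(q)}_{ji}$. **Proposition.** For all $a\ge1$ and $b\ge0$, $$\Phi_{a,b}(\bar u,\bar v)=T_{12}(u_1)\,\Phi_{a-1,b}(\bar u_1,\bar v)+\sum_{j=1}^b\lambda_2(v_j)\,g(v_j,u_1)\,f(v_j,\bar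 u_1)\,g(\bar v_j,v_j)\,T_{13}(u_1)\,\Phi_{a-1,b-1}(\bar u_1,\bar v_j),$$ where $\bar u_1$ (resp. $\bar v_j$) is $\bar u$ without its entry $u_1$ (resp. $\bar v$ without its entry $v_j$), $f(v_j,\bar u_1)=\prod_{k=2}^a f(v_j,u_k)$ and $g(\bar v_j,v_j)=\prod_{k\ne j}g(v_k,v_j)$. This holds in both of the following settings. (i) *Formal spectral parameters.* $V$ is any representation of $Y(2|1)$ with singular vector $\Omega\in V$; the spectral parameters are $u=1/x_s$ for formal variables $x_s$ ($s\in\sigma$), where the variables used for $v_1,\dots,v_b$ are pairwise distinct and different from those used for the $u_k$. The identity holds in $V[[x_s:s\in\sigma]]$ with scalars extended to the field of fractions of $\mathbb C[[x_s:s\in\sigma]]$. (ii) *Complex spectral parameters.* $V$ is a complex vector space with operators $T_{ij}(u)$, $u\in D\subseteq\mathbb C$, that satisfy $(\ast)$ for all $z\ne w$ in $D$, and $\Omega\in V$ is singular for all $u\in D$; the $u_k$, $v_j$ lie in $D$, the $v_j$ are pairwise distinct and different from all $u_k$, and $h(v_j,v_k)\ne0$ for all $j,k$. -/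

import Mathlib

noncomputable section

namespace SuperYangian

/-! ### Scalar functions -/

section Scalars

variable {K : Type*} [Field K]

/-- `g(u,v) = c / (u - v)`. -/
def g (c u v : K) : K := c / (u - v)

/-- `f(u,v) = 1 + g(u,v)`. -/
def f (c u v : K) : K := 1 + g c u v

/-- `h(u,v) = f(u,v) / g(u,v) = (u - v + c) / c`. -/
def h (c u v : K) : K := (u - v + c) / c

/-- `H(v₁,…,v_b) = ∏_{k < j} h(v_j, v_k)`. -/
def H (c : K) {b : ℕ} (v : Fin b → K) : K :=
  ∏ j, ∏ k ∈ Finset.Iio j, h c (v j) (v k)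

end Scalars

/-- The grading of `ℂ^{2|1}`: with the basis indexed by `0, 1, 2` (for `1, 2, 3`),
the first two basis vectors are even and the last one is odd. -/
def gr (i : Fin 3) : ℕ := if i = 2 then 1 else 0

/-! ### The super-Yangian `Y(2|1)` -/

/-- The free algebra on the modes `T_{ij}^{(p)}`, `p = 0, 1, 2, …`. -/
abbrev FreeModes : Type := FreeAlgebra ℂ (Fin 3 × Fin 3 × ℕ)

/-- The coefficient of `(c/u)^r` in `T_{ij}(u) = δ_{ij} + ∑_{p ≥ 0} T_{ij}^{(p)} (c/u)^{p+1}`. -/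
def freeCoeff (i j : Fin 3) : ℕ → FreeModes
  | 0 => if i = j then 1 else 0
  | p + 1 => FreeAlgebra.ι ℂ (i, j, p)

/-- The defining relations of `Y(2|1)`. After multiplication by `z - w`, the `RTT` relation reads
in components
`(z - w) [T_{ij}(z), T_{kl}(w)} =
  (-1)^{[l]([i]+[j]) + [i][j]} c (T_{il}(z) T_{kj}(w) - T_{il}(w) T_{kj}(z))`,
with the graded commutator
`[T_{ij}(z), T_{kl}(w)} = T_{ij}(z) T_{kl}(w) - (-1)^{([i]+[j])([k]+[l])} T_{kl}(w) T_{ij}(z)`.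
The relation below is the coefficient of `c (c/z)^r (c/w)^s`. -/
inductive Rel : FreeModes → FreeModes → Prop
  | rtt (i j k l : Fin 3) (r s : ℕ) :
      Rel
        ((freeCoeff i j (r + 1) * freeCoeff k l s
            - (-1) ^ ((gr i + gr j) * (gr k + gr l)) * (freeCoeff k l s * freeCoeff i j (r + 1)))
          - (freeCoeff i j r * freeCoeff k l (s + 1)
            - (-1) ^ ((gr i + gr j) * (gr k + gr l)) * (freeCoeff k l (s + 1) * freeCoeff i j r)))
        ((-1) ^ (gr l * (gr i + gr j) + gr i * gr j) *
          (freeCoeff i l r * freeCoeff k j s - freeCoeff i l s * freeCoeff k j r))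

/-- The super-Yangian `Y(2|1)`, as an associative unital algebra over `ℂ`. -/
abbrev Yangian : Type := RingQuot Rel

/-- The coefficient of `(c/u)^r` in `T_{ij}(u)`, as an element of `Y(2|1)`. -/
def coeffT (i j : Fin 3) (r : ℕ) : Yangian := RingQuot.mkAlgHom ℂ Rel (freeCoeff i j r)

/-- The mode `T_{ij}^{(p)}` in `Y(2|1)`. -/
def modeT (i j : Fin 3) (p : ℕ) : Yangian := coeffT i j (p + 1)

/-- The component form of the `RTT` relation at two points `z ≠ w`, for families `Tz = T(z)` and
`Tw = T(w)` of elements of an algebra: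
`[T_{ij}(z), T_{kl}(w)} =
  (-1)^{[l]([i]+[j]) + [i][j]} g(z,w) (T_{il}(z) T_{kj}(w) - T_{il}(w) T_{kj}(z))`. -/
def RTT {K A : Type*} [Field K] [Ring A] [Algebra K A] (c z w : K) (Tz Tw : Fin 3 → Fin 3 → A) :
    Prop :=
  ∀ i j k l : Fin 3,
    Tz i j * Tw k l - (-1) ^ ((gr i + gr j) * (gr k + gr l)) * (Tw k l * Tz i j) =
      ((-1) ^ (gr l * (gr i + gr j) + gr i * gr j) * g c z w) •
        (Tz i l * Tw k j - Tw i l * Tz k j)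

/-! ### The graded tensor product of auxiliary spaces -/

section Auxiliary

variable {K : Type*} [Field K] {N : ℕ}

variable (K N) in
/-- Endomorphisms of `(ℂ^{2|1})^{⊗ N}`, as matrices in the basis `e_{I 0} ⊗ ⋯ ⊗ e_{I (N-1)}`. -/
abbrev AuxMat : Type _ := Matrix (Fin N → Fin 3) (Fin N → Fin 3) K

/-- The elementary matrix `E_{ij}` in the `p`-th copy of the graded tensor product:
`E_{ij}^{(p)}` sends `e_J` to `(-1)^{([i]+[j]) ∑_{q<p} [J q]} δ_{j, J p} e_{J'}`, where `J'` is `J`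
with `J p` replaced by `i`. In particular `E_{ij}^{(p)} E_{kl}^{(q)} =
(-1)^{([i]+[j])([k]+[l])} E_{kl}^{(q)} E_{ij}^{(p)}` for `p ≠ q`. -/
def E (p : Fin N) (i j : Fin 3) : AuxMat K N :=
  fun I J =>
    if J p = j ∧ I = Function.update J p i then
      (-1) ^ ((gr i + gr j) * ∑ q ∈ Finset.Iio p, gr (J q))
    else 0

/-- The graded permutation `P_{pq} = ∑_{i,j} (-1)^{[j]} E_{ij}^{(p)} E_{ji}^{(q)}`. -/
def P (p q : Fin N) : AuxMat K N :=
  ∑ i, ∑ j, ((-1 : K) ^ gr j) • (E p i j * E q j i)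

/-- The `R`-matrix `R_{pq}(x,y) = 1 + g(x,y) P_{pq}`. -/
def R (c : K) (p q : Fin N) (x y : K) : AuxMat K N := 1 + g c x y • P p q

/-- The super-trace over all `N` auxiliary spaces. -/
def str (M : AuxMat K N) : K := ∑ I : Fin N → Fin 3, (-1) ^ (∑ p, gr (I p)) * M I I

/-- `(R_{a+1,a} ⋯ R_{a+1,1}) (R_{a+2,a} ⋯ R_{a+2,1}) ⋯ (R_{a+b,a} ⋯ R_{a+b,1})`,
with `R_{a+j,k} = R_{a+j,k}(v_j, u_k)`. -/
def RR (c : K) {a b : ℕ} (u : Fin a → K) (v : Fin b → K) : AuxMat K (a + b) :=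
  ((List.finRange b).map fun j =>
    ((List.finRange a).reverse.map fun k =>
      R c (Fin.natAdd a j) (Fin.castAdd b k) (v j) (u k)).prod).prod

variable (K) in
/-- `E_{21}^{(1)} ⋯ E_{21}^{(a)} E_{32}^{(a+1)} ⋯ E_{32}^{(a+b)}`. -/
def lowering (a b : ℕ) : AuxMat K (a + b) :=
  ((List.finRange a).map fun k => E (Fin.castAdd b k) 1 0).prod *
    ((List.finRange b).map fun j => E (Fin.natAdd a j) 2 1).prod

/-- The exponent of the sign produced in the graded tensor product when, in
`(E_{I_1 J_1}^{(1)} T_{I_1 J_1}) ⋯ (E_{I_N J_N}^{(N)} T_{I_N J_N}) X`,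
with `X` an auxiliary matrix of parity `d` and `T_{ij}` of parity `[i]+[j]`, all auxiliary matrices
are moved to the left of all the `T`'s: `E^{(q)}` passes the `T` of each space `p < q`,
and `X` passes all the `T`'s. -/
def koszul (d : ℕ) (I J : Fin N → Fin 3) : ℕ :=
  (∑ q, ∑ p ∈ Finset.Iio q, (gr (I p) + gr (J p)) * (gr (I q) + gr (J q)))
    + d * ∑ p, (gr (I p) + gr (J p))

/-- The operator `str_{1⋯N} [T_1(w_1) ⋯ T_N(w_N) X]`, where `T_p(w_p) = ∑_{ij} E_{ij}^{(p)} T_{ij}(w_p)`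
and `X` is an auxiliary matrix of parity `d`. -/
def strT {W : Type*} [AddCommGroup W] [Module K W] (T : Fin N → Fin 3 → Fin 3 → Module.End K W)
    (d : ℕ) (X : AuxMat K N) : Module.End K W :=
  ∑ I : Fin N → Fin 3, ∑ J : Fin N → Fin 3,
    ((-1) ^ koszul d I J * str ((List.ofFn fun p => E p (I p) (J p)).prod * X)) •
      (List.ofFn fun p => T p (I p) (J p)).prod

/-- The Bethe vector
`Φ_{a,b}(u,v) = (-1)^b / H(v) str_{1⋯a+b} [T_1(u_1) ⋯ T_a(u_a) T_{a+1}(v_1) ⋯ T_{a+b}(v_b)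
  RR E_{21}^{(1)} ⋯ E_{21}^{(a)} E_{32}^{(a+1)} ⋯ E_{32}^{(a+b)}] Ω`
for the ordered lists of parameters `us` of length `a` and `vs` of length `b`. Parameters are labelled
by a type `ι`; the label `s` stands for the spectral parameter `z s`, and `T s i j` is
`T_{ij}(z s)`. The auxiliary matrix has parity `b`. -/
def Φ {ι W : Type*} [AddCommGroup W] [Module K W] (c : K) (z : ι → K)
    (T : ι → Fin 3 → Fin 3 → Module.End K W) (Ω : W) (us vs : List ι) : W :=
  ((-1) ^ vs.length / H c (fun j => z (vs.get j))) •
    strT (fun p => T (Fin.append us.get vs.get p)) vs.length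
      (RR c (fun k => z (us.get k)) (fun j => z (vs.get j)) * lowering K us.length vs.length) Ω

end Auxiliary

/-! ### Representations with formal spectral parameters -/

section Formal

/-- `V[[x_s : s ∈ σ]]`: formal power series in commuting variables with coefficients in `V`. -/
def VecSeries (σ V : Type*) : Type _ := (σ →₀ ℕ) → V

instance (σ V : Type*) [AddCommGroup V] : AddCommGroup (VecSeries σ V) :=
  inferInstanceAs (AddCommGroup ((σ →₀ ℕ) → V))

variable {σ V : Type*} [AddCommGroup V]

open Classical in
/-- The Cauchy product of a series of scalars (or operators) and a series of vectors. -/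
instance {A : Type*} [Semiring A] [Module A V] : SMul (MvPowerSeries σ A) (VecSeries σ V) where
  smul F w := fun n => ∑ p ∈ Finset.HasAntidiagonal.antidiagonal n, MvPowerSeries.coeff p.1 F • w p.2

open Classical in
theorem VecSeries.smul_apply {A : Type*} [Semiring A] [Module A V] (F : MvPowerSeries σ A)
    (w : VecSeries σ V) (n : σ →₀ ℕ) :
    (F • w) n = ∑ p ∈ Finset.HasAntidiagonal.antidiagonal n, MvPowerSeries.coeff p.1 F • w p.2 := rfl

theorem VecSeries.add_apply (w w' : VecSeries σ V) (n : σ →₀ ℕ) : (w + w') n = w n + w' n := rfl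

theorem VecSeries.zero_apply (n : σ →₀ ℕ) : (0 : VecSeries σ V) n = 0 := rfl

instance {A : Type*} [Semiring A] [Module A V] : Module (MvPowerSeries σ A) (VecSeries σ V) where
  one_smul w := by
    classical
    funext n
    rw [VecSeries.smul_apply, Finset.sum_eq_single ((0 : σ →₀ ℕ), n)]
    · simp
    · rintro ⟨p, q⟩ hpq hne
      have hp : p ≠ 0 := by
        rintro rfl
        simp_all
      simp [MvPowerSeries.coeff_one, hp]
    · simp
  mul_smul F G w := by
    classical
    funext n
    simp only [VecSeries.smul_apply, MvPowerSeries.coeff_mul, Finset.sum_smul, Finset.smul_sum,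
      mul_smul, Finset.sum_sigma']
    refine Finset.sum_nbij' (fun ⟨⟨_i, j⟩, ⟨k, l⟩⟩ ↦ ⟨(k, l + j), (l, j)⟩)
      (fun ⟨⟨i, _j⟩, ⟨k, l⟩⟩ ↦ ⟨(i + k, l), (i, k)⟩) ?_ ?_ ?_ ?_ ?_ <;>
      rintro ⟨⟨p, q⟩, ⟨k, l⟩⟩ hm <;>
      simp only [Finset.mem_sigma, Finset.HasAntidiagonal.mem_antidiagonal] at hm ⊢ <;>
      obtain ⟨rfl, rfl⟩ := hm <;> simp [add_assoc]
  smul_zero F := by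
    funext n
    simp [VecSeries.smul_apply, VecSeries.zero_apply]
  smul_add F w w' := by
    funext n
    simp [VecSeries.smul_apply, VecSeries.add_apply, Finset.sum_add_distrib]
  add_smul F G w := by
    funext n
    simp [VecSeries.smul_apply, VecSeries.add_apply, Finset.sum_add_distrib, add_smul]
  zero_smul w := by
    funext n
    simp [VecSeries.smul_apply, VecSeries.zero_apply]

variable [Module ℂ V]

/-- The `ℂ[[x_s]]`-linear operator on `V[[x_s]]` given by a power series of operators on `V`. -/
def seriesOp (F : MvPowerSeries σ (Module.End ℂ V)) :
    Module.End (MvPowerSeries σ ℂ) (VecSeries σ V) where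
  toFun w := F • w
  map_add' := smul_add F
  map_smul' a w := by
    have hmap : ∀ w : VecSeries σ V,
        a • w = MvPowerSeries.map (algebraMap ℂ (Module.End ℂ V)) a • w := by
      intro w
      funext n
      simp [VecSeries.smul_apply]
    have hcomm : F * MvPowerSeries.map (algebraMap ℂ (Module.End ℂ V)) a
        = MvPowerSeries.map (algebraMap ℂ (Module.End ℂ V)) a * F := by
      classical
      ext1 n
      rw [MvPowerSeries.coeff_mul, MvPowerSeries.coeff_mul]
      refine Finset.sum_nbij' Prod.swap Prod.swap ?_ ?_ ?_ ?_ ?_ <;> rintro ⟨p, q⟩ hm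
      · simpa [add_comm] using hm
      · simpa [add_comm] using hm
      · rfl
      · rfl
      · simp only [Prod.fst_swap, Prod.snd_swap, MvPowerSeries.coeff_map]
        exact (Algebra.commutes _ _).symm
    simp only [RingHom.id_apply]
    rw [hmap, hmap, ← mul_smul, ← mul_smul, hcomm]

open Classical in
/-- For a sequence `t` in a `ℂ`-module, the series `∑_r t_r (c x_s)^r` in the single variable `x_s`;
it stands for `∑_r t_r (c / u)^r` with `u = 1 / x_s`. -/
def genSeries {A : Type*} [AddCommGroup A] [Module ℂ A] (c : ℂ) (t : ℕ → A) (s : σ) :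
    MvPowerSeries σ A :=
  fun n => if n = Finsupp.single s (n s) then c ^ n s • t (n s) else 0

variable (σ) in
/-- The field of fractions of `ℂ[[x_s : s ∈ σ]]`. -/
abbrev Scal : Type _ := FractionRing (MvPowerSeries σ ℂ)

variable (σ V) in
/-- `V[[x_s : s ∈ σ]]` with scalars extended to the field of fractions of `ℂ[[x_s : s ∈ σ]]`. -/
abbrev Vec : Type _ := TensorProduct (MvPowerSeries σ ℂ) (Scal σ) (VecSeries σ V)

/-- The spectral parameter `u = 1 / x_s`. -/
def param (s : σ) : Scal σ :=
  (algebraMap (MvPowerSeries σ ℂ) (Scal σ) (MvPowerSeries.X s))⁻¹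

/-- The operator `T_{ij}(1 / x_s)` attached to a representation `ρ` of `Y(2|1)` on `V`. -/
def formalT (c : ℂ) (ρ : Yangian →ₐ[ℂ] Module.End ℂ V) (s : σ) (i j : Fin 3) :
    Module.End (Scal σ) (Vec σ V) :=
  (seriesOp (genSeries c (fun r => ρ (coeffT i j r)) s)).baseChange (Scal σ)

/-- The scalar `1 + ∑_{p ≥ 0} l_p (c / u)^{p+1}` for `u = 1 / x_s`. -/
def formalWeight (c : ℂ) (l : ℕ → ℂ) (s : σ) : Scal σ :=
  algebraMap (MvPowerSeries σ ℂ) (Scal σ)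
    (genSeries c (fun r => match r with | 0 => 1 | p + 1 => l p) s)

open Classical in
variable (σ) in
/-- A vector of `V`, seen as a constant series. -/
def constVec (w : V) : Vec σ V :=
  TensorProduct.tmul (MvPowerSeries σ ℂ) (1 : Scal σ)
    ((fun n => if n = 0 then w else 0 : (σ →₀ ℕ) → V) : VecSeries σ V)

/-- The Bethe vector `Φ_{a,b}(u,v)` attached to a representation `ρ` of `Y(2|1)` on `V` and a vector
`Ω ∈ V`, at the formal spectral parameters `1 / x_s` for `s` in the lists `us` and `vs`. -/
def formalΦ (c : ℂ) (ρ : Yangian →ₐ[ℂ] Module.End ℂ V) (Ω : V) (us vs : List σ) : Vec σ V :=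
  Φ (algebraMap ℂ (Scal σ) c) param (formalT c ρ) (constVec σ Ω) us vs

end Formal

end SuperYangian

end

/-! The lowering matrix is a single matrix unit with an even column, so the super-trace collapses to
one row: up to the factor `H`, the Bethe vector is the entry at e_2^{⊗a} ⊗ e_3^{⊗b} of the row
T_{1·}(u_1) ⋯ T_{1·}(u_a) T_{2·}(v_1) ⋯ T_{2·}(v_b) Ω multiplied by the R-matrices
(`Φ_eq_dressedRow`). The remaining sign is constant because R-matrices conserve parity.

The auxiliary spaces of the u_k are now read as sites of a spin chain. The R-matrices attached to
one u_k multiply the second row t(v) of a monodromy matrix on the right by L(v) = 1 + g(v,u_k)P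
(`dress`, `foldl_siteAct`). As for a coproduct, this preserves the relations inside the second row
(`RowRTT.dress`), and it multiplies the vacuum eigenvalue of t_22(v) by f(v,u_k). Hence Φ_{a,b} is,
up to `H`, a linear image of t_23(v_1) ⋯ t_23(v_b) vac, where t_22(v) has vacuum eigenvalue λ_2(v) ∏
f(v,u_k) (`exists_dressed_module`).

Separating only the site of u_1 from the chain gives the recursion. In the dressed product that site
either stays in e_2 or is flipped once to e_3 (`dress_offProd`). The flip trades one t_23 for t_22,
which is moved to the vacuum by the usual Bethe ansatz exchange (`diag_offProd`). Contracting the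
site with T_{1m}(u_1) yields the T_12 term and the T_13 terms. The scalars combine through one
partial fraction identity (`g_mul_g`), and `exchangeCoeff_mul_H` accounts for the normalisation.

The argument runs over an arbitrary field with labelled parameters (`Φ_cons`). For formal parameters
the field is the fraction field of the power series ring, and the mode relations supply the RTT
relation there. -/

noncomputable section

namespace SuperYangian

/-! ### Row vectors, graded matrix units and R-matrices -/

section RowAction

variable {K : Type*} [Field K] {N : ℕ} {W : Type*} [AddCommGroup W] [Module K W]

/-- The right action of auxiliary matrices on row vectors with entries in a `K`-module. -/
def rowAct (w : (Fin N → Fin 3) → W) (M : AuxMat K N) : (Fin N → Fin 3) → W :=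
  fun J => ∑ I, M I J • w I

theorem rowAct_one (w : (Fin N → Fin 3) → W) : rowAct w (1 : AuxMat K N) = w := by
  funext J
  simp [rowAct, Matrix.one_apply]

theorem rowAct_mul (w : (Fin N → Fin 3) → W) (M M' : AuxMat K N) :
    rowAct w (M * M') = rowAct (rowAct w M) M' := by
  funext J
  simp only [rowAct, Matrix.mul_apply, Finset.sum_smul, Finset.smul_sum, smul_smul]
  rw [Finset.sum_comm]
  simp only [mul_comm]

theorem rowAct_add (w : (Fin N → Fin 3) → W) (M M' : AuxMat K N) :
    rowAct w (M + M') = rowAct w M + rowAct w M' := by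
  funext J
  simp [rowAct, add_smul, Finset.sum_add_distrib]

theorem rowAct_smul (w : (Fin N → Fin 3) → W) (a : K) (M : AuxMat K N) :
    rowAct w (a • M) = a • rowAct w M := by
  funext J
  simp [rowAct, Finset.smul_sum, smul_smul]

theorem rowAct_sum {α : Type*} (s : Finset α) (w : (Fin N → Fin 3) → W) (M : α → AuxMat K N) :
    rowAct w (∑ a ∈ s, M a) = ∑ a ∈ s, rowAct w (M a) := by
  funext J
  simp only [rowAct, Matrix.sum_apply, Finset.sum_smul, Finset.sum_apply]
  rw [Finset.sum_comm]

theorem rowAct_injective {M M' : AuxMat K N}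
    (hM : ∀ w : (Fin N → Fin 3) → K, rowAct w M = rowAct w M') : M = M' := by
  ext I J
  simpa [rowAct, Pi.single_apply] using congrFun (hM (Pi.single I 1)) J

theorem rowAct_E (w : (Fin N → Fin 3) → W) (p : Fin N) (i j : Fin 3) (J : Fin N → Fin 3) :
    rowAct w (E p i j : AuxMat K N) J =
      if J p = j then
        ((-1 : K) ^ ((gr i + gr j) * ∑ q ∈ Finset.Iio p, gr (J q))) • w (Function.update J p i)
      else 0 := by
  simp only [rowAct, E]
  split_ifs with h
  · rw [Finset.sum_eq_single (Function.update J p i)]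
    · simp [h]
    · intro I _ hI
      simp [hI]
    · simp
  · simp [h]

/-- Written additively on both sides to avoid truncated subtraction of parities. -/
theorem sum_Iio_update {p q : Fin N} (J : Fin N → Fin 3) (i : Fin 3) :
    ∑ r ∈ Finset.Iio q, gr (Function.update J p i r) + (if p < q then gr (J p) else 0) =
      ∑ r ∈ Finset.Iio q, gr (J r) + (if p < q then gr i else 0) := by
  split_ifs with h
  · rw [← Finset.sum_erase_add _ _ (Finset.mem_Iio.2 h),
      ← Finset.sum_erase_add (Finset.Iio q) (fun r => gr (J r)) (Finset.mem_Iio.2 h)]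
    have : ∑ r ∈ (Finset.Iio q).erase p, gr (Function.update J p i r) =
        ∑ r ∈ (Finset.Iio q).erase p, gr (J r) :=
      Finset.sum_congr rfl fun r hr => by
        rw [Function.update_of_ne (Finset.ne_of_mem_erase hr)]
    rw [this, Function.update_self]
    ring
  · congr 1
    refine Finset.sum_congr rfl fun r hr => ?_
    rw [Function.update_of_ne]
    rintro rfl
    exact h (Finset.mem_Iio.1 hr)

theorem neg_one_pow_congr_mod {m n : ℕ} (hmn : m % 2 = n % 2) : (-1 : K) ^ m = (-1) ^ n := by
  rw [neg_one_pow_eq_pow_mod_two, hmn, ← neg_one_pow_eq_pow_mod_two]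

/-- Changing the state of the earlier space alters the parity sum seen by the later one by [i]+[j]
or [k]+[l] modulo 2; the other parity sum is unaffected. This one discrepancy is the graded
commutation sign. -/
theorem E_mul_E {p q : Fin N} (hpq : p ≠ q) (i j k l : Fin 3) :
    (E p i j * E q k l : AuxMat K N) =
      ((-1 : K) ^ ((gr i + gr j) * (gr k + gr l))) • (E q k l * E p i j) := by
  refine rowAct_injective fun w => ?_
  funext J
  simp only [rowAct_mul, rowAct_smul, rowAct_E, Pi.smul_apply, Function.update_of_ne hpq,
    Function.update_of_ne hpq.symm]
  by_cases hp : J p = j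
  swap
  · simp [hp]
  by_cases hq : J q = l
  swap
  · simp [hq]
  subst hp hq
  simp only [if_true, smul_smul, Function.update_comm hpq, ← pow_add]
  congr 1
  refine neg_one_pow_congr_mod ?_
  have h1 := sum_Iio_update (p := p) (q := q) J i
  have h2 := sum_Iio_update (p := q) (q := p) J k
  set a := ∑ r ∈ Finset.Iio q, gr (Function.update J p i r)
  set b := ∑ r ∈ Finset.Iio p, gr (Function.update J q k r)
  set a' := ∑ r ∈ Finset.Iio q, gr (J r)
  set b' := ∑ r ∈ Finset.Iio p, gr (J r)
  have hg : ∀ i : Fin 3, gr i = 0 ∨ gr i = 1 := by decide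
  rcases lt_or_gt_of_ne hpq with h | h
  · rw [if_pos h, if_pos h] at h1
    rw [if_neg h.not_gt, if_neg h.not_gt] at h2
    rcases hg i with h3 | h3 <;> rcases hg (J p) with h4 | h4 <;> rcases hg k with h5 | h5 <;>
      rcases hg (J q) with h6 | h6 <;> simp only [h3, h4, h5, h6] at * <;> omega
  · rw [if_pos h, if_pos h] at h2
    rw [if_neg h.not_gt, if_neg h.not_gt] at h1
    rcases hg i with h3 | h3 <;> rcases hg (J p) with h4 | h4 <;> rcases hg k with h5 | h5 <;>
      rcases hg (J q) with h6 | h6 <;> simp only [h3, h4, h5, h6] at * <;> omega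

theorem commute_P {p q r s : Fin N} (hpr : p ≠ r) (hps : p ≠ s) (hqr : q ≠ r) (hqs : q ≠ s) :
    Commute (P p q : AuxMat K N) (P r s) := by
  unfold P
  refine Commute.sum_left _ _ _ fun i _ => Commute.sum_left _ _ _ fun j _ =>
    Commute.sum_right _ _ _ fun k _ => Commute.sum_right _ _ _ fun l _ =>
      (Commute.smul_left (Commute.smul_right ?_ _) _)
  have hs : ∀ e : ℕ, (-1 : K) ^ e * (-1) ^ e = 1 := fun e => by
    rw [← mul_pow]; simp
  have hX : ∀ (t : Fin N), p ≠ t → q ≠ t → ∀ m n : Fin 3,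
      Commute (E p i j * E q j i : AuxMat K N) (E t m n) := by
    intro t hp hq m n
    show _ * _ = _ * _
    rw [mul_assoc, E_mul_E hq, mul_smul_comm, ← mul_assoc, E_mul_E hp, smul_mul_assoc, smul_smul,
      mul_assoc, add_comm (gr j), hs, one_smul]
  exact (hX r hpr hqr k l).mul_right (hX s hps hqs l k)

theorem commute_R (c : K) {p q r s : Fin N} (x y x' y' : K)
    (hpr : p ≠ r) (hps : p ≠ s) (hqr : q ≠ r) (hqs : q ≠ s) :
    Commute (R c p q x y) (R c r s x' y') := by
  unfold R
  refine (Commute.one_left _).add_left (Commute.smul_left ?_ _)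
  exact (Commute.one_right _).add_right (Commute.smul_right (commute_P hpr hps hqr hqs) _)

/-- Parities of the spaces left of `q` are counted by both matrix units and cancel, so the sign
involves only the two swapped spaces and those strictly between them. This locality is what later
allows a first tensor factor to be split off. -/
theorem rowAct_P (w : (Fin N → Fin 3) → W) {p q : Fin N} (hqp : q < p) (J : Fin N → Fin 3) :
    rowAct w (P p q : AuxMat K N) J =
      ((-1 : K) ^ (gr (J p) * gr (J q) +
          (gr (J p) + gr (J q)) * ∑ r ∈ Finset.Ioo q p, gr (J r))) •
        w (Function.update (Function.update J q (J p)) p (J q)) := by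
  simp only [P, rowAct_sum, rowAct_smul, rowAct_mul, Finset.sum_apply, Pi.smul_apply]
  simp only [rowAct_E, Function.update_of_ne hqp.ne']
  rw [Finset.sum_eq_single (J q), Finset.sum_eq_single (J p)]
  · simp only [if_true, smul_smul, ← pow_add]
    congr 1
    refine neg_one_pow_congr_mod ?_
    have h1 := sum_Iio_update (p := q) (q := p) J (J p)
    rw [if_pos hqp, if_pos hqp] at h1
    have h2 : ∑ r ∈ Finset.Iio p, gr (J r) =
        ∑ r ∈ Finset.Iio q, gr (J r) + gr (J q) + ∑ r ∈ Finset.Ioo q p, gr (J r) := by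
      have : Finset.Iio p = (insert q (Finset.Iio q)) ∪ Finset.Ioo q p := by
        ext r
        simp only [Finset.mem_Iio, Finset.mem_union, Finset.mem_insert, Finset.mem_Ioo]
        omega
      rw [this, Finset.sum_union, Finset.sum_insert (by simp)]
      · ring
      · rw [Finset.disjoint_left]
        intro r
        simp only [Finset.mem_Iio, Finset.mem_insert, Finset.mem_Ioo]
        omega
    set a := ∑ r ∈ Finset.Iio p, gr (Function.update J q (J p) r)
    have hg : ∀ i : Fin 3, gr i = 0 ∨ gr i = 1 := by decide
    rcases hg (J p) with h4 | h4 <;> rcases hg (J q) with h5 | h5 <;>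
      simp only [h4, h5] at * <;> omega
  · intro j _ hj
    simp [hj.symm]
  · simp
  · intro i _ hi
    simp [hi.symm]
  · simp

theorem rowAct_R (c x y : K) (w : (Fin N → Fin 3) → W) {p q : Fin N} (hqp : q < p)
    (J : Fin N → Fin 3) :
    rowAct w (R c p q x y) J = w J +
      (g c x y * (-1 : K) ^ (gr (J p) * gr (J q) +
          (gr (J p) + gr (J q)) * ∑ r ∈ Finset.Ioo q p, gr (J r))) •
        w (Function.update (Function.update J q (J p)) p (J q)) := by
  rw [R, rowAct_add, rowAct_one, rowAct_smul, Pi.add_apply, Pi.smul_apply, rowAct_P _ hqp,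
    smul_smul]

end RowAction

/-! ### Collapse of the super-trace -/

section MatrixUnits

variable {K : Type*} [Field K] {N : ℕ} {W : Type*} [AddCommGroup W] [Module K W]

/-- In increasing order, the parity sum at a space never meets a state that a factor further right
has changed. Hence all signs can be read off from `J` alone. -/
theorem rowAct_prod_E (w : (Fin N → Fin 3) → W) (i j : Fin N → Fin 3) (l : List (Fin N))
    (hl : l.Pairwise (· < ·)) (J : Fin N → Fin 3) :
    rowAct w ((l.map fun p => E p (i p) (j p)).prod : AuxMat K N) J =
      if ∀ p ∈ l, J p = j p then
        ((-1 : K) ^ (l.map fun p =>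
          (gr (i p) + gr (j p)) * ∑ q ∈ Finset.Iio p, gr (J q)).sum) •
            w (fun p => if p ∈ l then i p else J p)
      else 0 := by
  induction l generalizing w with
  | nil => simp [rowAct_one]
  | cons p l ih =>
    rw [List.pairwise_cons] at hl
    have hp : p ∉ l := fun h => lt_irrefl _ (hl.1 p h)
    rw [List.map_cons, List.prod_cons, rowAct_mul, ih _ hl.2]
    by_cases h : ∀ q ∈ l, J q = j q
    swap
    · rw [if_neg h, if_neg]
      exact fun h' => h fun q hq => h' q (List.mem_cons_of_mem _ hq)
    rw [if_pos h, rowAct_E, if_neg hp]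
    by_cases hpj : J p = j p
    swap
    · rw [if_neg hpj, smul_zero, if_neg]
      exact fun h' => hpj (h' p List.mem_cons_self)
    rw [if_pos hpj, if_pos, smul_smul, ← pow_add]
    swap
    · simpa [hpj] using h
    have hsum : ∑ q ∈ Finset.Iio p, gr (if q ∈ l then i q else J q) =
        ∑ q ∈ Finset.Iio p, gr (J q) :=
      Finset.sum_congr rfl fun q hq => by
        rw [if_neg]
        exact fun h' => (Finset.mem_Iio.1 hq).asymm (hl.1 q h')
    rw [hsum, List.map_cons, List.sum_cons, add_comm]
    congr 2
    funext q
    by_cases hq : q = p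
    · subst hq
      simp
    · simp [hq]

theorem prod_ofFn_E_apply (i j I J : Fin N → Fin 3) :
    ((List.ofFn fun p => E p (i p) (j p)).prod : AuxMat K N) I J =
      if I = i ∧ J = j then
        (-1 : K) ^ ∑ p, (gr (i p) + gr (j p)) * ∑ q ∈ Finset.Iio p, gr (j q)
      else 0 := by
  have h := rowAct_prod_E (K := K) (Pi.single I (1 : K)) i j (List.finRange N)
    (List.pairwise_lt_finRange N) J
  rw [List.ofFn_eq_map]
  simp only [rowAct, smul_eq_mul, Pi.single_apply, mul_ite, mul_one, mul_zero,
    Finset.sum_ite_eq', Finset.mem_univ, if_true, List.mem_finRange, true_imp_iff] at h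
  rw [h]
  simp only [← funext_iff]
  by_cases hJ : J = j
  · subst hJ
    by_cases hI : I = i
    · subst hI
      simp [← List.ofFn_eq_map, List.sum_ofFn]
    · have : ¬ (fun p => i p) = I := fun h' => hI h'.symm
      simp [hI, this]
  · simp [hJ]

theorem lowering_eq (a b : ℕ) :
    lowering K a b = (List.ofFn fun p => E p
      (Fin.append (fun _ : Fin a => (1 : Fin 3)) (fun _ : Fin b => 2) p)
      (Fin.append (fun _ : Fin a => (0 : Fin 3)) (fun _ : Fin b => 1) p)).prod := by
  rw [List.ofFn_add, List.prod_append]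
  simp [lowering, List.ofFn_eq_map]
  rfl

/-- The column states e_1 and e_2 are even, so every sign in the product of matrix units is trivial.
-/
theorem lowering_apply (a b : ℕ) (I J : Fin (a + b) → Fin 3) :
    lowering K a b I J =
      if I = Fin.append (fun _ : Fin a => (1 : Fin 3)) (fun _ : Fin b => 2) ∧
        J = Fin.append (fun _ : Fin a => (0 : Fin 3)) (fun _ : Fin b => 1) then 1 else 0 := by
  have h0 : ∀ q, gr (Fin.append (fun _ : Fin a => (0 : Fin 3)) (fun _ : Fin b => 1) q) = 0 := by
    intro q
    induction q using Fin.addCases <;> simp [gr]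
  rw [lowering_eq, prod_ofFn_E_apply]
  simp [h0]

/-- The matrix unit fixes the row indices of the T's to the even states (1,…,1,2,…,2), where the
super-trace sign is trivial. The quadratic part of the Koszul sign cancels against the sign of the
ordered product of the E's; only the passage of the parity `b` matrix through the T's remains. -/
theorem strT_mul_lowering {a b : ℕ} (T : Fin (a + b) → Fin 3 → Fin 3 → Module.End K W)
    (X : AuxMat K (a + b)) :
    strT T b (X * lowering K a b) = ∑ J : Fin (a + b) → Fin 3,
      (X J (Fin.append (fun _ => 1) (fun _ => 2)) * (-1) ^ (b * ∑ p, gr (J p))) •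
        (List.ofFn fun p => T p (Fin.append (fun _ : Fin a => (0 : Fin 3))
          (fun _ : Fin b => 1) p) (J p)).prod := by
  set A : Fin (a + b) → Fin 3 := Fin.append (fun _ => 1) (fun _ => 2) with hA
  set B : Fin (a + b) → Fin 3 := Fin.append (fun _ => 0) (fun _ => 1) with hB
  have h0 : ∀ q, gr (B q) = 0 := by
    intro q
    induction q using Fin.addCases <;> simp [gr, hB]
  have hX : ∀ L I, (X * lowering K a b) L I = if I = B then X L A else 0 := by
    intro L I
    simp only [Matrix.mul_apply, lowering_apply, ← hA, ← hB]
    by_cases hI : I = B <;> simp [hI]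
  have hstr : ∀ I J : Fin (a + b) → Fin 3,
      str ((List.ofFn fun p => E p (I p) (J p)).prod * (X * lowering K a b)) =
        if I = B then (-1 : K) ^ (∑ p, (gr (B p) + gr (J p)) * ∑ q ∈ Finset.Iio p, gr (J q)) *
          X J A else 0 := by
    intro I J
    simp only [str, Matrix.mul_apply (M := (List.ofFn fun p => E p (I p) (J p)).prod),
      prod_ofFn_E_apply, hX]
    rw [Finset.sum_eq_single B]
    · rw [Finset.sum_eq_single J]
      · by_cases hI : I = B
        · subst hI
          simp [h0]
        · have : ¬ B = I := fun h => hI h.symm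
          simp [hI, this]
      · intro L _ hL
        simp [hL]
      · simp
    · intro L _ hL
      simp [hL]
    · simp
  unfold strT
  simp only [hstr]
  rw [Finset.sum_eq_single B]
  · refine Finset.sum_congr rfl fun J _ => ?_
    rw [if_pos rfl]
    congr 1
    rw [← mul_assoc, ← pow_add, mul_comm]
    congr 1
    refine neg_one_pow_congr_mod ?_
    simp only [koszul, h0, zero_add]
    have : ∑ q, ∑ p ∈ Finset.Iio q, gr (J p) * gr (J q) =
        ∑ p, gr (J p) * ∑ q ∈ Finset.Iio p, gr (J q) :=
      Finset.sum_congr rfl fun q _ => by rw [← Finset.sum_mul, mul_comm]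
    rw [this]
    omega
  · intro I _ hI
    simp [hI]
  · simp

end MatrixUnits

/-! ### The Bethe vector as one entry of a dressed row -/

section Reduction

variable {K : Type*} [Field K] {W : Type*} [AddCommGroup W] [Module K W] {ι : Type*}

/-- The row vector `J ↦ T_{1,J_1}(u_1) ⋯ T_{1,J_a}(u_a) T_{2,J_{a+1}}(v_1) ⋯ T_{2,J_{a+b}}(v_b) Ω`. -/
def monodromyRow (T : ι → Fin 3 → Fin 3 → Module.End K W) (Ω : W) {a b : ℕ}
    (u : Fin a → ι) (v : Fin b → ι) : (Fin (a + b) → Fin 3) → W := fun J =>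
  (List.ofFn fun k => T (u k) 0 (J (Fin.castAdd b k))).prod
    ((List.ofFn fun j => T (v j) 1 (J (Fin.natAdd a j))).prod Ω)

/-- The component along `e_2^{⊗ a} ⊗ e_{l_1} ⊗ ⋯ ⊗ e_{l_b}` of the monodromy row multiplied
by the product of `R`-matrices. -/
def dressedRow (c : K) (z : ι → K) (T : ι → Fin 3 → Fin 3 → Module.End K W) (Ω : W) {a b : ℕ}
    (u : Fin a → ι) (v : Fin b → ι) (l : Fin b → Fin 3) : W :=
  rowAct (monodromyRow T Ω u v) (RR c (fun k => z (u k)) (fun j => z (v j)))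
    (Fin.append (fun _ => 1) l)

/-- Conservation of parity lets the leftover sign be evaluated at the output state, where it is
constant. -/
theorem rowAct_parity {N : ℕ} (m : ℕ) (w : (Fin N → Fin 3) → W) (M : AuxMat K N)
    (hM : ∀ I J, M I J ≠ 0 → ∑ p, gr (I p) = ∑ p, gr (J p)) (J : Fin N → Fin 3) :
    rowAct (fun I => ((-1 : K) ^ (m * ∑ p, gr (I p))) • w I) M J =
      ((-1 : K) ^ (m * ∑ p, gr (J p))) • rowAct w M J := by
  simp only [rowAct, Finset.smul_sum]
  refine Finset.sum_congr rfl fun I _ => ?_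
  by_cases h : M I J = 0
  · simp [h]
  · rw [hM I J h, smul_comm]

theorem sum_gr_swap {N : ℕ} {p q : Fin N} (J : Fin N → Fin 3) :
    ∑ r, gr (Function.update (Function.update J q (J p)) p (J q) r) = ∑ r, gr (J r) := by
  have : Function.update (Function.update J q (J p)) p (J q) = J ∘ Equiv.swap p q := by
    funext r
    by_cases hp : r = p
    · subst hp
      simp
    by_cases hq : r = q
    · subst hq
      simp [Function.update_of_ne hp]
    · simp [Function.update_of_ne hp, Function.update_of_ne hq, Equiv.swap_apply_of_ne_of_ne hp hq]
  rw [this]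
  exact Equiv.sum_comp (Equiv.swap p q) fun r => gr (J r)

theorem sum_gr_of_R_apply_ne_zero {N : ℕ} (c x y : K) {p q : Fin N} (hqp : q < p)
    (I J : Fin N → Fin 3) (hI : R c p q x y I J ≠ 0) : ∑ r, gr (I r) = ∑ r, gr (J r) := by
  have h := rowAct_R c x y (Pi.single I (1 : K)) hqp J
  have h' : rowAct (Pi.single I (1 : K)) (R c p q x y) J = R c p q x y I J := by
    simp [rowAct, Pi.single_apply]
  rw [h'] at h
  by_contra hne
  apply hI
  rw [h, Pi.single_eq_of_ne, Pi.single_eq_of_ne]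
  · simp
  · rintro rfl
    exact hne (sum_gr_swap J)
  · rintro rfl
    exact hne rfl

theorem sum_gr_of_list_prod_apply_ne_zero {N : ℕ} (L : List (AuxMat K N))
    (hL : ∀ M ∈ L, ∀ I J, M I J ≠ 0 → ∑ p, gr (I p) = ∑ p, gr (J p)) (I J : Fin N → Fin 3)
    (hI : L.prod I J ≠ 0) : ∑ p, gr (I p) = ∑ p, gr (J p) := by
  induction L generalizing I with
  | nil =>
    by_contra hne
    apply hI
    rw [List.prod_nil, Matrix.one_apply_ne]
    rintro rfl
    exact hne rfl
  | cons M L ih =>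
    rw [List.prod_cons, Matrix.mul_apply] at hI
    obtain ⟨J', -, hJ'⟩ := Finset.exists_ne_zero_of_sum_ne_zero hI
    rw [hL M List.mem_cons_self I J' (left_ne_zero_of_mul hJ')]
    exact ih (fun M' hM' => hL M' (List.mem_cons_of_mem _ hM')) J' (right_ne_zero_of_mul hJ')

theorem sum_gr_of_RR_apply_ne_zero (c : K) {a b : ℕ} (u : Fin a → K) (v : Fin b → K)
    (I J : Fin (a + b) → Fin 3) (hI : RR c u v I J ≠ 0) : ∑ p, gr (I p) = ∑ p, gr (J p) := by
  refine sum_gr_of_list_prod_apply_ne_zero _ (fun M hM => ?_) I J hI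
  obtain ⟨j, -, rfl⟩ := List.mem_map.1 hM
  refine sum_gr_of_list_prod_apply_ne_zero _ fun M' hM' => ?_
  obtain ⟨k, -, rfl⟩ := List.mem_map.1 hM'
  refine sum_gr_of_R_apply_ne_zero c _ _ ?_
  simp only [Fin.lt_def, Fin.val_castAdd, Fin.val_natAdd]
  omega

theorem Φ_eq_dressedRow (c : K) (z : ι → K) (T : ι → Fin 3 → Fin 3 → Module.End K W) (Ω : W)
    (us vs : List ι) :
    Φ c z T Ω us vs = (H c fun j => z (vs.get j))⁻¹ •
      dressedRow c z T Ω us.get vs.get (fun _ => 2) := by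
  have hprod : ∀ J : Fin (us.length + vs.length) → Fin 3,
      (List.ofFn fun p => T (Fin.append us.get vs.get p) (Fin.append
        (fun _ : Fin us.length => (0 : Fin 3)) (fun _ : Fin vs.length => 1) p) (J p)).prod Ω =
      monodromyRow T Ω us.get vs.get J := by
    intro J
    rw [List.ofFn_add, List.prod_append]
    simp [monodromyRow]
    rfl
  have hpar := rowAct_parity vs.length (monodromyRow T Ω us.get vs.get)
    (RR c (fun k => z (us.get k)) (fun j => z (vs.get j)))
    (sum_gr_of_RR_apply_ne_zero c _ _) (Fin.append (fun _ => 1) (fun _ => 2))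
  rw [Φ, strT_mul_lowering, LinearMap.sum_apply]
  simp only [LinearMap.smul_apply, hprod, mul_smul]
  have hgr : ∑ p, gr ((Fin.append (fun _ : Fin us.length => (1 : Fin 3))
      (fun _ : Fin vs.length => 2) : Fin (us.length + vs.length) → Fin 3) p) = vs.length := by
    rw [Fin.sum_univ_add]
    simp [gr]
  rw [hgr] at hpar
  simp only [rowAct] at hpar
  rw [hpar, smul_smul, dressedRow, rowAct]
  congr 1
  -- The output state has parity b, so the prefactor and the leftover sign combine to an even
  -- exponent b(b+1).
  have h1 : (-1 : K) ^ vs.length * (-1) ^ (vs.length * vs.length) = 1 := by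
    rw [← pow_add, Even.neg_one_pow]
    rw [add_comm, ← Nat.mul_succ]
    exact Nat.even_mul_succ_self _
  rw [div_mul_eq_mul_div, h1, one_div]

end Reduction

/-! ### Splitting off the auxiliary space of u_1 -/

/-- Insertion of a first tensor factor in the state `e_m`. -/
def insertFirst {α : Type*} {a b : ℕ} (m : Fin 3) (w : (Fin (a + 1 + b) → Fin 3) → α) :
    (Fin (a + b) → Fin 3) → α := fun J =>
  w (Fin.append (Fin.cons m fun k => J (Fin.castAdd b k) : Fin (a + 1) → Fin 3)
    fun j => J (Fin.natAdd a j))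

theorem insertFirst_append {α : Type*} {a b : ℕ} (m : Fin 3) (w : (Fin (a + 1 + b) → Fin 3) → α)
    (n : Fin a → Fin 3) (l : Fin b → Fin 3) :
    insertFirst m w (Fin.append n l) = w (Fin.append (Fin.cons m n : Fin (a + 1) → Fin 3) l) := by
  simp [insertFirst]

section Recursion

variable {K : Type*} [Field K] {W : Type*} [AddCommGroup W] [Module K W] {ι : Type*}

theorem list_prod_map_mul_of_commute {α M : Type*} [Monoid M] (X Y : α → M) (L : List α)
    (hL : L.Nodup) (hXY : ∀ i j, i ≠ j → Commute (Y i) (X j)) :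
    (L.map fun j => X j * Y j).prod = (L.map X).prod * (L.map Y).prod := by
  induction L with
  | nil => simp
  | cons i L ih =>
    rw [List.nodup_cons] at hL
    have hi : Commute (Y i) (L.map X).prod := by
      refine Commute.list_prod_right _ _ fun m hm => ?_
      obtain ⟨j, hj, rfl⟩ := List.mem_map.1 hm
      exact hXY i j fun h => hL.1 (h ▸ hj)
    simp only [List.map_cons, List.prod_cons, ih hL.2]
    rw [mul_assoc, ← mul_assoc (Y i), hi.eq]
    simp only [mul_assoc]

theorem sum_Ioo_castAdd_natAdd {a b : ℕ} (F : Fin (a + b) → ℕ) (k : Fin a) (j : Fin b) :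
    ∑ r ∈ Finset.Ioo (Fin.castAdd b k) (Fin.natAdd a j), F r =
      ∑ k' ∈ Finset.Ioi k, F (Fin.castAdd b k') + ∑ j' ∈ Finset.Iio j, F (Fin.natAdd a j') := by
  have h1 : Finset.Ioo (Fin.castAdd b k) (Fin.natAdd a j) = Finset.univ.filter
      fun r => Fin.castAdd b k < r ∧ r < Fin.natAdd a j := by ext; simp
  have h2 : Finset.Ioi k = Finset.univ.filter fun r => k < r := by ext; simp
  have h3 : Finset.Iio j = Finset.univ.filter fun r => r < j := by ext; simp
  rw [h1, h2, h3, Finset.sum_filter, Finset.sum_filter, Finset.sum_filter, Fin.sum_univ_add]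
  congr 1
  · refine Finset.sum_congr rfl fun r _ => ?_
    have : (Fin.castAdd b k < Fin.castAdd b r ∧ Fin.castAdd b r < Fin.natAdd a j) ↔ k < r := by
      simp only [Fin.lt_def, Fin.val_castAdd, Fin.val_natAdd]
      omega
    simp only [this]
  · refine Finset.sum_congr rfl fun r _ => ?_
    have : (Fin.castAdd b k < Fin.natAdd a r ∧ Fin.natAdd a r < Fin.natAdd a j) ↔ r < j := by
      simp only [Fin.lt_def, Fin.val_castAdd, Fin.val_natAdd]
      omega
    simp only [this]

theorem update_append {α : Type*} {a b : ℕ} (n : Fin a → α) (l : Fin b → α) (k : Fin a) (j : Fin b)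
    (x y : α) :
    Function.update (Function.update (Fin.append n l) (Fin.castAdd b k) x) (Fin.natAdd a j) y =
      Fin.append (Function.update n k x) (Function.update l j y) := by
  have hne : ∀ (k : Fin a) (j : Fin b), Fin.castAdd b k ≠ Fin.natAdd a j := by
    intro k j h
    have := congrArg Fin.val h
    simp only [Fin.val_castAdd, Fin.val_natAdd] at this
    omega
  funext r
  induction r using Fin.addCases with
  | left r =>
    rw [Function.update_of_ne (hne _ _), Fin.append_left]
    by_cases h : r = k
    · subst h
      simp
    · rw [Function.update_of_ne h, Function.update_of_ne, Fin.append_left]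
      exact fun h' => h (Fin.castAdd_injective _ _ h')
  | right r =>
    rw [Fin.append_right]
    by_cases h : r = j
    · subst h
      simp
    · rw [Function.update_of_ne h, Function.update_of_ne, Function.update_of_ne (hne _ _).symm,
        Fin.append_right]
      exact fun h' => h (Fin.natAdd_injective _ _ h')

theorem rowAct_R_append (c x y : K) {a b : ℕ} (w : (Fin (a + b) → Fin 3) → W) (k : Fin a)
    (j : Fin b) (n : Fin a → Fin 3) (l : Fin b → Fin 3) :
    rowAct w (R c (Fin.natAdd a j) (Fin.castAdd b k) x y) (Fin.append n l) =
      w (Fin.append n l) + (g c x y * (-1 : K) ^ (gr (l j) * gr (n k) + (gr (l j) + gr (n k)) *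
        (∑ k' ∈ Finset.Ioi k, gr (n k') + ∑ j' ∈ Finset.Iio j, gr (l j')))) •
        w (Fin.append (Function.update n k (l j)) (Function.update l j (n k))) := by
  rw [rowAct_R, update_append, sum_Ioo_castAdd_natAdd]
  · simp only [Fin.append_left, Fin.append_right]
  · simp only [Fin.lt_def, Fin.val_castAdd, Fin.val_natAdd]
    omega

/-- The first factor lies outside the interval between the two permuted spaces, so its state
produces no sign. -/
theorem insertFirst_rowAct_R (c x y : K) {a b : ℕ} (w : (Fin (a + 1 + b) → Fin 3) → W) (m : Fin 3)
    (k : Fin a) (j : Fin b) :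
    insertFirst m (rowAct w (R c (Fin.natAdd (a + 1) j) (Fin.castAdd b k.succ) x y)) =
      rowAct (insertFirst m w) (R c (Fin.natAdd a j) (Fin.castAdd b k) x y) := by
  funext J
  rw [← Fin.append_castAdd_natAdd (f := J), insertFirst_append, rowAct_R_append, rowAct_R_append,
    insertFirst_append, insertFirst_append, Fin.cons_update, Fin.Ioi_succ, Finset.sum_map]
  simp only [Fin.cons_succ, Fin.coe_succEmb]

theorem insertFirst_rowAct_prod {a b : ℕ} (m : Fin 3) {α : Type*} (L : List α)
    (M : α → AuxMat K (a + 1 + b)) (M' : α → AuxMat K (a + b))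
    (hM : ∀ i, ∀ w : (Fin (a + 1 + b) → Fin 3) → W,
      insertFirst m (rowAct w (M i)) = rowAct (insertFirst m w) (M' i))
    (w : (Fin (a + 1 + b) → Fin 3) → W) :
    insertFirst m (rowAct w (L.map M).prod) = rowAct (insertFirst m w) (L.map M').prod := by
  induction L generalizing w with
  | nil => simp [rowAct_one]
  | cons i L ih => simp only [List.map_cons, List.prod_cons, rowAct_mul, ih, hM]

/-- The action of one `R`-matrix on the state `n` of a site and the states `l` of the spaces
attached to the parameters `v_1, …, v_b`. -/
def siteAct {b : ℕ} (x : K) (j : Fin b) (G : Fin 3 → (Fin b → Fin 3) → W) :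
    Fin 3 → (Fin b → Fin 3) → W := fun n l =>
  G n l + (x * (-1 : K) ^ (gr (l j) * gr n + (gr (l j) + gr n) * ∑ j' ∈ Finset.Iio j, gr (l j'))) •
    G (l j) (Function.update l j n)

/-- The spaces of the remaining u_k sit in the even state e_2 and give no sign, so the first site
interacts with the v-spaces alone. -/
theorem rowAct_prod_R_first (c y : K) {a b : ℕ} (v : Fin b → K) (L : List (Fin b))
    (w : (Fin (a + 1 + b) → Fin 3) → W) (m : Fin 3) (l : Fin b → Fin 3) :
    rowAct w (L.map fun j => R c (Fin.natAdd (a + 1) j) (Fin.castAdd b 0) (v j) y).prod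
        (Fin.append (Fin.cons m fun _ => 1 : Fin (a + 1) → Fin 3) l) =
      L.foldl (fun G j => siteAct (g c (v j) y) j G)
        (fun n l => w (Fin.append (Fin.cons n fun _ => 1 : Fin (a + 1) → Fin 3) l)) m l := by
  induction L generalizing w with
  | nil => simp [rowAct_one]
  | cons j L ih =>
    rw [List.map_cons, List.prod_cons, rowAct_mul, ih, List.foldl_cons]
    refine congrFun (congrFun (congrArg (fun G => List.foldl _ G _) ?_) _) _
    funext n l
    rw [rowAct_R_append, siteAct]
    have : ∑ k' ∈ Finset.Ioi (0 : Fin (a + 1)), gr ((Fin.cons n fun _ => 1 : Fin (a + 1) → Fin 3) k')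
        = 0 := by
      refine Finset.sum_eq_zero fun k hk => ?_
      obtain ⟨k, rfl⟩ := Fin.exists_succ_eq.2 (Finset.mem_Ioi.1 hk).ne'
      simp [gr]
    rw [this, zero_add, Fin.cons_zero, Fin.update_cons_zero]

/-- Within each block the factor acting on space 1 comes last, and it commutes with the factors of
later blocks that act on other u-spaces. All such factors can therefore be collected on the right.
-/
theorem RR_succ (c : K) {a b : ℕ} (u : Fin (a + 1) → K) (v : Fin b → K) :
    RR c u v =
      ((List.finRange b).map fun j => ((List.finRange a).reverse.map fun k =>
        R c (Fin.natAdd (a + 1) j) (Fin.castAdd b k.succ) (v j) (u k.succ)).prod).prod *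
      ((List.finRange b).map fun j =>
        R c (Fin.natAdd (a + 1) j) (Fin.castAdd b 0) (v j) (u 0)).prod := by
  have hne : ∀ (k : Fin (a + 1)) (j : Fin b), Fin.natAdd (a + 1) j ≠ Fin.castAdd b k := by
    intro k j h
    have := congrArg Fin.val h
    simp only [Fin.val_castAdd, Fin.val_natAdd] at this
    omega
  rw [← list_prod_map_mul_of_commute _ _ _ (List.nodup_finRange b)]
  · simp [RR, List.finRange_succ, Function.comp_def]
  · intro i j hij
    refine Commute.list_prod_right _ _ fun m hm => ?_
    obtain ⟨k, -, rfl⟩ := List.mem_map.1 hm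
    refine commute_R c _ _ _ _ (fun h => hij (Fin.natAdd_injective _ _ h)) (hne _ _)
      (hne _ _).symm fun h => ?_
    exact (Fin.succ_ne_zero k) (Fin.castAdd_injective _ _ h).symm

theorem rowAct_comp_linearMap {N : ℕ} {W' : Type*} [AddCommGroup W'] [Module K W'] (φ : W →ₗ[K] W')
    (w : (Fin N → Fin 3) → W) (M : AuxMat K N) (J : Fin N → Fin 3) :
    rowAct (fun I => φ (w I)) M J = φ (rowAct w M J) := by
  simp [rowAct, map_sum]

/-- The leftmost operator T_{1n}(u_1) commutes, by linearity, with the scalar action of the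
R-matrices not touching space 1. What it acts on is the dressed row with u_1 removed. -/
theorem dressedRow_succ (c : K) (z : ι → K) (T : ι → Fin 3 → Fin 3 → Module.End K W) (Ω : W)
    {a b : ℕ} (u : Fin (a + 1) → ι) (v : Fin b → ι) (l : Fin b → Fin 3) :
    dressedRow c z T Ω u v l =
      (List.finRange b).foldl (fun G j => siteAct (g c (z (v j)) (z (u 0))) j G)
        (fun n l => T (u 0) 0 n (dressedRow c z T Ω (fun k => u k.succ) v l)) 1 l := by
  have h1 : (Fin.append (fun _ => 1) l : Fin (a + 1 + b) → Fin 3) =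
      Fin.append (Fin.cons 1 fun _ => 1 : Fin (a + 1) → Fin 3) l := by
    congr 1
    funext k
    induction k using Fin.cases <;> simp
  rw [dressedRow, h1, RR_succ, rowAct_mul, rowAct_prod_R_first]
  refine congrFun (congrFun (congrArg (fun G => List.foldl _ G _) ?_) _) _
  funext n l
  refine (insertFirst_append n (rowAct _ _) _ l).symm.trans ?_
  rw [insertFirst_rowAct_prod (M' := fun j =>
    ((List.finRange a).reverse.map fun k =>
      R c (Fin.natAdd a j) (Fin.castAdd b k) (z (v j)) (z (u k.succ))).prod)]
  · rw [dressedRow, RR, ← rowAct_comp_linearMap]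
    congr 1
    funext J
    simp [insertFirst, monodromyRow, List.ofFn_succ]
  · intro j w
    exact insertFirst_rowAct_prod n _ _ _ (fun k w => insertFirst_rowAct_R c _ _ w n k j) w

end Recursion

/-! ### R-matrices as one extra site of the monodromy matrix -/

section Dressing

variable {K : Type*} [Field K] {W : Type*} [AddCommGroup W] [Module K W]
  {X : Type*} [AddCommGroup X] [Module K X]

/-- The second row of a monodromy matrix with one more site, in terms of the second row `t` of the
given one; `x` stands for `g(v,u)`. -/
def dress (x : K) (t : Fin 3 → Module.End K X) (l : Fin 3) : Module.End K (Fin 3 → X) :=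
  LinearMap.pi fun m => ((-1 : K) ^ (gr m * gr l)) • (t l ∘ₗ LinearMap.proj m) +
    if m = l then x • ∑ k, t k ∘ₗ LinearMap.proj k else 0

theorem dress_apply (x : K) (t : Fin 3 → Module.End K X) (l : Fin 3) (y : Fin 3 → X) (m : Fin 3) :
    dress x t l y m = ((-1 : K) ^ (gr m * gr l)) • t l (y m) +
      if m = l then x • ∑ k, t k (y k) else 0 := by
  simp only [dress, LinearMap.pi_apply, LinearMap.add_apply, LinearMap.smul_apply,
    LinearMap.comp_apply, LinearMap.proj_apply]
  split_ifs <;> simp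

/-- Each later R-matrix passes the spectator state `l₀`. The resulting signs amount to conjugation
by the sign of exchanging the site with `l₀`. -/
theorem foldl_siteAct_succ {b : ℕ} (x : Fin (b + 1) → K) (L : List (Fin b)) (l₀ : Fin 3)
    (G : Fin 3 → (Fin (b + 1) → Fin 3) → W) (n : Fin 3) (l : Fin b → Fin 3) :
    L.foldl (fun G j => siteAct (x j.succ) j.succ G) G n (Fin.cons l₀ l) =
      ((-1 : K) ^ (gr n * gr l₀)) • L.foldl (fun G j => siteAct (x j.succ) j G)
        (fun n l => ((-1 : K) ^ (gr n * gr l₀)) • G n (Fin.cons l₀ l)) n l := by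
  have hs : ∀ e : ℕ, (-1 : K) ^ e * (-1) ^ e = 1 := fun e => by
    rw [← mul_pow]; simp
  induction L generalizing G with
  | nil => simp [smul_smul, hs]
  | cons j L ih =>
    rw [List.foldl_cons, List.foldl_cons, ih]
    congr 1
    refine congrFun (congrFun (congrArg (fun G => List.foldl _ G _) ?_) _) _
    funext n l
    simp only [siteAct, Fin.cons_succ, smul_add, smul_smul, ← Fin.cons_update]
    congr 2
    have : ∑ j' ∈ Finset.Iio j.succ, gr ((Fin.cons l₀ l : Fin (b + 1) → Fin 3) j') =
        gr l₀ + ∑ j' ∈ Finset.Iio j, gr (l j') := by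
      have h1 : Finset.Iio j.succ = Finset.univ.filter fun r => r < j.succ := by ext; simp
      have h2 : Finset.Iio j = Finset.univ.filter fun r => r < j := by ext; simp
      rw [h1, h2, Finset.sum_filter, Finset.sum_filter, Fin.sum_univ_succ]
      simp
    rw [this, mul_left_comm, mul_assoc, ← pow_add, ← pow_add]
    congr 1
    refine neg_one_pow_congr_mod ?_
    generalize ∑ j' ∈ Finset.Iio j, gr (l j') = S
    have hg : ∀ i : Fin 3, gr i = 0 ∨ gr i = 1 := by decide
    rcases hg n with h1 | h1 <;> rcases hg (l j) with h2 | h2 <;> rcases hg l₀ with h3 | h3 <;>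
      simp only [h1, h2, h3] <;> omega

/-- This converts right multiplication by R-matrices on auxiliary indices into a product of
operators on three copies of `X`. The functional `φ` must be general, since each step of the
induction changes it. -/
theorem foldl_siteAct {b : ℕ} (x : Fin b → K) (t : Fin b → Fin 3 → Module.End K X)
    (φ : Fin 3 → X →ₗ[K] W) (vac : X) (n : Fin 3) (l : Fin b → Fin 3) :
    (List.finRange b).foldl (fun G j => siteAct (x j) j G)
        (fun n l => φ n ((List.ofFn fun j => t j (l j)).prod vac)) n l =
      ((-1 : K) ^ (gr n * ∑ j, gr (l j))) •
        ∑ m, φ m ((List.ofFn fun j => dress (x j) (t j) (l j)).prod (Pi.single n vac) m) := by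
  induction b generalizing φ n with
  | zero =>
    simp only [List.finRange_zero, List.foldl_nil, List.ofFn_zero, List.prod_nil, Module.End.one_apply,
      Finset.univ_eq_empty, Finset.sum_empty, mul_zero, pow_zero, one_smul]
    rw [Finset.sum_eq_single n]
    · simp
    · intro m _ hm
      simp [hm]
    · simp
  | succ b ih =>
    obtain ⟨l₀, l, rfl⟩ : ∃ l₀ l', l = (Fin.cons l₀ l' : Fin (b + 1) → Fin 3) :=
      ⟨l 0, Fin.tail l, (Fin.cons_self_tail l).symm⟩
    rw [List.finRange_succ, List.foldl_cons, List.foldl_map, foldl_siteAct_succ]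
    have h := ih (fun j => x j.succ) (fun j => t j.succ)
      (fun n => ((-1 : K) ^ (gr n * gr l₀)) • φ n ∘ₗ t 0 l₀ + x 0 • φ l₀ ∘ₗ t 0 n) n l
    -- The first R-matrix and the leftmost operator `t 0` are absorbed into a new functional, to
    -- which the induction hypothesis applies.
    have hG : (fun n l => ((-1 : K) ^ (gr n * gr l₀)) • siteAct (x 0) 0
        (fun n l => φ n ((List.ofFn fun j => t j (l j)).prod vac)) n
          (Fin.cons l₀ l : Fin (b + 1) → Fin 3)) =
        fun n l => (((-1 : K) ^ (gr n * gr l₀)) • φ n ∘ₗ t 0 l₀ + x 0 • φ l₀ ∘ₗ t 0 n)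
          ((List.ofFn fun j => t j.succ (l j)).prod vac) := by
      funext n l
      have hs : (-1 : K) ^ (gr n * gr l₀) * (x 0 * (-1 : K) ^ (gr l₀ * gr n)) = x 0 := by
        rw [mul_left_comm, mul_comm (gr l₀), ← mul_pow]
        simp
      simp only [siteAct, Fin.cons_zero, Fin.update_cons_zero, List.ofFn_succ, List.prod_cons,
        Fin.cons_succ, Module.End.mul_apply, LinearMap.add_apply, LinearMap.smul_apply,
        LinearMap.comp_apply, smul_add, smul_smul]
      have h0 : Finset.Iio (0 : Fin (b + 1)) = ∅ := by ext; simp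
      rw [h0, Finset.sum_empty, mul_zero, add_zero, hs]
    have hgr : ∑ j, gr ((Fin.cons l₀ l : Fin (b + 1) → Fin 3) j) = gr l₀ + ∑ j, gr (l j) := by
      simp [Fin.sum_univ_succ]
    rw [hG, h, smul_smul, ← pow_add, hgr, mul_add]
    simp only [Fin.cons_zero, Fin.cons_succ, List.ofFn_succ, List.prod_cons, Module.End.mul_apply,
      dress_apply, map_add, Finset.sum_add_distrib, LinearMap.add_apply, LinearMap.smul_apply,
      LinearMap.comp_apply, map_smul]
    congr 2
    symm
    rw [Finset.sum_eq_single l₀ (fun m _ hm => by rw [if_neg hm, map_zero]) (by simp), if_pos rfl,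
      map_smul, map_sum, Finset.smul_sum]

end Dressing

/-! ### Relations inside the second row and their stability under dressing -/

section RowRelations

variable {K : Type*} [Field K] {X : Type*} [AddCommGroup X] [Module K X]

/-- The `RTT` relations between the entries of the second row of a monodromy matrix at the points
`z` and `w`. -/
def RowRTT (c z w : K) (tz tw : Fin 3 → Module.End K X) : Prop :=
  ∀ j l : Fin 3, tz j * tw l - ((-1 : K) ^ (gr j * gr l)) • (tw l * tz j) =
    ((-1 : K) ^ (gr j * gr l) * g c z w) • (tz l * tw j - tw l * tz j)

theorem neg_one_pow_mul_eq_smul (e : ℕ) (A : Module.End K X) :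
    (-1) ^ e * A = ((-1 : K) ^ e) • A := by
  rcases Nat.even_or_odd e with he | he
  · rw [he.neg_one_pow, he.neg_one_pow, one_mul, one_smul]
  · rw [he.neg_one_pow, he.neg_one_pow, neg_one_mul, neg_one_smul]

/-- With both row indices equal to 2, the right-hand side stays in that row; since this index is
even, the sign exponents reduce to the column parities. -/
theorem RTT.rowRTT {c z w : K} {Tz Tw : Fin 3 → Fin 3 → Module.End K X} (hT : RTT c z w Tz Tw) :
    RowRTT c z w (Tz 1) (Tw 1) := by
  intro j l
  have h1 := hT 1 j 1 l
  have hg1 : gr 1 = 0 := by simp [gr]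
  simp only [hg1, zero_add, zero_mul, add_zero] at h1
  rw [neg_one_pow_mul_eq_smul] at h1
  rw [h1, mul_comm (gr l)]

theorem g_swap (c x y : K) : g c y x = -g c x y := by
  rw [g, g, ← neg_sub x y, div_neg]

/-- Partial fractions; this is the only scalar identity behind the exchange and dressing
computations. -/
theorem g_mul_g {c x y u : K} (hxy : x ≠ y) (hxu : x ≠ u) (hyu : y ≠ u) :
    g c x u * g c y u = g c x y * g c y u - g c x y * g c x u := by
  unfold g
  have h1 := sub_ne_zero.2 hxy
  have h2 := sub_ne_zero.2 hxu
  have h3 := sub_ne_zero.2 hyu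
  field_simp
  ring

theorem dress_mul_dress_apply {c z w u : K} (hzw : z ≠ w) (hzu : z ≠ u) (hwu : w ≠ u)
    {tz tw : Fin 3 → Module.End K X} (ht : RowRTT c z w tz tw) (j l m : Fin 3) (y : Fin 3 → X) :
    (dress (g c z u) tz j * dress (g c w u) tw l) y m =
      ((-1 : K) ^ (gr m * gr j) * (-1) ^ (gr m * gr l)) • tz j (tw l (y m)) +
      (if m = l then ((-1 : K) ^ (gr m * gr j) * g c w u) • tz j (∑ k, tw k (y k)) else 0) +
      if m = j then (g c z u * (1 - g c z w)) • tw l (∑ k, tz k (y k)) +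
        (g c z w * g c w u) • tz l (∑ k, tw k (y k)) else 0 := by
  -- Reordering t_k(z) t_l(w) makes the contraction over k act directly on `y`, so both orders of
  -- the product are expressed by the same contracted vectors.
  have hsum : ∑ k, ((-1 : K) ^ (gr k * gr l)) • tz k (tw l (y k)) =
      tw l (∑ k, tz k (y k)) +
        g c z w • (tz l (∑ k, tw k (y k)) - tw l (∑ k, tz k (y k))) := by
    simp only [map_sum, ← Finset.sum_sub_distrib, Finset.smul_sum, ← Finset.sum_add_distrib]
    refine Finset.sum_congr rfl fun k _ => ?_
    have h := LinearMap.congr_fun (ht k l) (y k)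
    simp only [LinearMap.sub_apply, LinearMap.smul_apply, Module.End.mul_apply] at h
    have hs : (-1 : K) ^ (gr k * gr l) * (-1) ^ (gr k * gr l) = 1 := by
      rw [← mul_pow]; simp
    generalize (-1 : K) ^ (gr k * gr l) = s at *
    have h' := congrArg (fun a => s • a) h
    simp only [smul_sub, smul_smul, ← mul_assoc, hs, one_mul, one_smul] at h'
    rw [sub_eq_iff_eq_add'] at h'
    rw [h', smul_sub]
  rw [Module.End.mul_apply, dress_apply, dress_apply]
  have hk : ∀ k, tz k (dress (g c w u) tw l y k) =
      ((-1 : K) ^ (gr k * gr l)) • tz k (tw l (y k)) +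
        if k = l then g c w u • tz l (∑ k, tw k (y k)) else 0 := by
    intro k
    rw [dress_apply, map_add, map_smul]
    split_ifs with h
    · rw [h, map_smul]
    · rw [map_zero]
  simp only [hk, Finset.sum_add_distrib, hsum, Finset.sum_ite_eq',
    Finset.mem_univ, if_true, map_add, map_smul, smul_add, smul_smul]
  have hg := g_mul_g (c := c) hzw hzu hwu
  split_ifs
  · rw [map_smul]
    linear_combination (norm := module) hg • tz l (∑ k, tw k (y k))
  · rw [map_smul]
    module
  · rw [map_zero]
    linear_combination (norm := module) hg • tz l (∑ k, tw k (y k))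
  · rw [map_zero]
    module

/-- Coproduct property: multiplication on the right by L keeps the second row within itself, so no
other rows are needed. The reversed relation serves to expand the product taken in the opposite
order. -/
theorem RowRTT.dress {c z w u : K} (hzw : z ≠ w) (hzu : z ≠ u) (hwu : w ≠ u)
    {tz tw : Fin 3 → Module.End K X} (ht : RowRTT c z w tz tw) (ht' : RowRTT c w z tw tz) :
    RowRTT c z w (dress (g c z u) tz) (dress (g c w u) tw) := by
  intro j l
  refine LinearMap.ext fun y => funext fun m => ?_
  simp only [LinearMap.sub_apply, LinearMap.smul_apply, Pi.sub_apply, Pi.smul_apply]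
  rw [dress_mul_dress_apply hzw hzu hwu ht, dress_mul_dress_apply hzw hzu hwu ht,
    dress_mul_dress_apply hzw.symm hwu hzu ht']
  have h := LinearMap.congr_fun (ht j l) (y m)
  simp only [LinearMap.sub_apply, LinearMap.smul_apply, Module.End.mul_apply] at h
  rw [g_swap c z w]
  by_cases hml : m = l
  · by_cases hmj : m = j
    · subst hml
      subst hmj
      simp only [if_true]
      have hs : (-1 : K) ^ (gr m * gr m) * (-1) ^ (gr m * gr m) = 1 := by
        rw [← mul_pow]; simp
      -- The sign squares to 1; splitting into ±1 leaves a linear identity for `module`.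
      rcases mul_self_eq_one_iff.1 hs with hs | hs <;> rw [hs] at h ⊢ <;>
        linear_combination (norm := module) h
    · subst hml
      simp only [if_true, if_neg hmj, mul_comm (gr j) (gr m)] at h ⊢
      have hs : (-1 : K) ^ (gr m * gr j) * (-1) ^ (gr m * gr j) = 1 := by
        rw [← mul_pow]; simp
      rcases mul_self_eq_one_iff.1 hs with hs | hs <;> rw [hs] at h ⊢
      · linear_combination (norm := module) ((-1 : K) ^ (gr m * gr m)) • h
      · linear_combination (norm := module) (-(-1 : K) ^ (gr m * gr m)) • h
  · by_cases hmj : m = j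
    · subst hmj
      simp only [if_true, if_neg hml] at h ⊢
      have hs : (-1 : K) ^ (gr m * gr l) * (-1) ^ (gr m * gr l) = 1 := by
        rw [← mul_pow]; simp
      rcases mul_self_eq_one_iff.1 hs with hs | hs <;> rw [hs] at h ⊢
      · linear_combination (norm := module) ((-1 : K) ^ (gr m * gr m)) • h
      · linear_combination (norm := module) (-(-1 : K) ^ (gr m * gr m)) • h
    · simp only [if_neg hml, if_neg hmj]
      linear_combination (norm := module) ((-1 : K) ^ (gr m * gr j) * (-1) ^ (gr m * gr l)) • h

theorem RowRTT.diag_mul_off {c z w : K} {tz tw : Fin 3 → Module.End K X} (ht : RowRTT c z w tz tw)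
    (y : X) : tz 1 (tw 2 y) = f c w z • tw 2 (tz 1 y) + g c z w • tz 2 (tw 1 y) := by
  have h := LinearMap.congr_fun (ht 1 2) y
  simp only [LinearMap.sub_apply, LinearMap.smul_apply, Module.End.mul_apply, gr, Fin.reduceEq,
    if_true, if_false, zero_mul, pow_zero, one_mul, one_smul] at h
  rw [f, g_swap c z w]
  linear_combination (norm := module) h

/-- The entry t_23 is odd, hence the minus sign. The factors f stay on both sides because they may
vanish. -/
theorem RowRTT.off_mul_off {c z w : K} {tz tw : Fin 3 → Module.End K X} (ht : RowRTT c z w tz tw)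
    (y : X) : f c z w • tz 2 (tw 2 y) = -f c w z • tw 2 (tz 2 y) := by
  have h := LinearMap.congr_fun (ht 2 2) y
  simp only [LinearMap.sub_apply, LinearMap.smul_apply, Module.End.mul_apply, gr] at h
  norm_num at h
  rw [f, f, g_swap c z w]
  linear_combination (norm := module) h

end RowRelations

/-! ### Algebraic Bethe ansatz for t_22 and t_23 -/

section BetheAnsatz

variable {K : Type*} [Field K] {ι : Type*}

/-- The coefficient `g(v̄_j, v_j) ∏_{k<j} h(v_j, v_k) ∏_{k>j} h(v_k, v_j)`. -/
def exchangeCoeff (c : K) (z : ι → K) : (vs : List ι) → Fin vs.length → K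
  | [] => fun j => j.elim0
  | v :: vs => Fin.cases (vs.map fun w => f c (z w) (z v)).prod
      fun j => -f c (z (vs.get j)) (z v) * exchangeCoeff c z vs j

variable {X : Type*} [AddCommGroup X] [Module K X]

/-- The vector `t_{23}(v_1) ⋯ t_{23}(v_b) Ω`. -/
def offProd (t : ι → Fin 3 → Module.End K X) (vac : X) (vs : List ι) : X :=
  (vs.map fun v => t v 2).prod vac

theorem offProd_cons (t : ι → Fin 3 → Module.End K X) (vac : X) (v : ι) (vs : List ι) :
    offProd t vac (v :: vs) = t v 2 (offProd t vac vs) := by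
  simp [offProd]

/-- Commuting t_22(x) past the t_23's either keeps the argument x throughout (wanted term) or
exchanges it with some v_j. Induction peels off the first t_23; moving t_23(x) back to the front
merges the two ways of obtaining each unwanted vector. -/
theorem diag_offProd {c : K} {z : ι → K} {t : ι → Fin 3 → Module.End K X} {vac : X} {α : ι → K}
    {S : Set ι} (ht : ∀ v ∈ S, ∀ w ∈ S, z v ≠ z w → RowRTT c (z v) (z w) (t v) (t w))
    (hα : ∀ v ∈ S, t v 1 vac = α v • vac) (x : ι) (vs : List ι) (hS : ∀ v ∈ x :: vs, v ∈ S)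
    (hvs : (x :: vs).Pairwise fun v w => z v ≠ z w) :
    t x 1 (offProd t vac vs) =
      (α x * (vs.map fun v => f c (z v) (z x)).prod) • offProd t vac vs +
        ∑ j : Fin vs.length, (α (vs.get j) * g c (z x) (z (vs.get j)) * exchangeCoeff c z vs j) •
          t x 2 (offProd t vac (vs.eraseIdx j)) := by
  induction vs generalizing x with
  | nil => simp [offProd, hα x (hS x List.mem_cons_self)]
  | cons v vs ih =>
    have hxS := hS x List.mem_cons_self
    have hvS := hS v (by simp)
    have hxv : z x ≠ z v := by simp at hvs; tauto
    have h1 := ih x (fun w hw => hS w (by simp at hw ⊢; tauto))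
      (hvs.sublist (by simp))
    have h2 := ih v (fun w hw => hS w (by simp at hw ⊢; tauto)) (List.pairwise_cons.1 hvs).2
    have hsum : ∀ F : Fin (v :: vs).length → X, ∑ j, F j = F 0 + ∑ j : Fin vs.length, F j.succ :=
      fun F => Fin.sum_univ_succ (n := vs.length) F
    rw [offProd_cons, (ht x hxS v hvS hxv).diag_mul_off, h1, h2, hsum]
    simp only [map_add, map_sum, map_smul, smul_add, Finset.smul_sum, smul_smul]
    have e0 : exchangeCoeff c z (v :: vs) 0 = (vs.map fun w => f c (z w) (z v)).prod := rfl
    have es : ∀ j : Fin vs.length, exchangeCoeff c z (v :: vs) j.succ =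
      -f c (z (vs.get j)) (z v) * exchangeCoeff c z vs j := fun j => rfl
    simp only [e0, es, Fin.val_zero, Fin.val_succ, List.eraseIdx_cons_zero,
      List.eraseIdx_cons_succ, List.get_cons_zero, List.get_cons_succ', List.map_cons,
      List.prod_cons, offProd_cons]
    -- After `off_mul_off` the total coefficient is -f(x,v)g(x,v_j) + g(x,v)g(v,v_j), and `g_mul_g`
    -- turns it into -f(v_j,v)g(x,v_j). This explains the recursive factor in `exchangeCoeff`.
    have hj : ∀ j : Fin vs.length,
        (f c (z v) (z x) * (α (vs.get j) * g c (z x) (z (vs.get j)) * exchangeCoeff c z vs j)) •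
            t v 2 (t x 2 (offProd t vac (vs.eraseIdx j))) +
          (g c (z x) (z v) * (α (vs.get j) * g c (z v) (z (vs.get j)) * exchangeCoeff c z vs j)) •
            t x 2 (t v 2 (offProd t vac (vs.eraseIdx j))) =
        (α (vs.get j) * g c (z x) (z (vs.get j)) *
          (-f c (z (vs.get j)) (z v) * exchangeCoeff c z vs j)) •
            t x 2 (t v 2 (offProd t vac (vs.eraseIdx j))) := by
      intro j
      have hBB := (ht x hxS v hvS hxv).off_mul_off (offProd t vac (vs.eraseIdx j))
      have hmem : vs.get j ∈ vs := List.get_mem _ _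
      have hxm : z x ≠ z (vs.get j) := (List.pairwise_cons.1 hvs).1 _ (by simp)
      have hvm : z v ≠ z (vs.get j) :=
        (List.pairwise_cons.1 (List.pairwise_cons.1 hvs).2).1 _ hmem
      have hg := g_mul_g (c := c) hxv hxm hvm
      have h3 := g_swap c (z v) (z (vs.get j))
      rw [f, f, g_swap c (z x) (z v)] at hBB
      simp only [f, h3, g_swap c (z x) (z v)]
      linear_combination (norm := module) (α (vs.get j) * g c (z x) (z (vs.get j)) *
        exchangeCoeff c z vs j) • hBB - (α (vs.get j) * exchangeCoeff c z vs j * hg) •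
          t x 2 (t v 2 (offProd t vac (vs.eraseIdx j)))
    rw [← Finset.sum_congr rfl fun j _ => hj j, Finset.sum_add_distrib]
    module

/-- A dressed t_23 changes the site state only into e_3. Starting from e_2, the flip contributes
t_22(v), resolved by `diag_offProd`; once the site is in e_3, it stays there. -/
theorem dress_offProd {c : K} {z : ι → K} {t : ι → Fin 3 → Module.End K X} {vac : X} {α : ι → K}
    {S : Set ι} (ht : ∀ v ∈ S, ∀ w ∈ S, z v ≠ z w → RowRTT c (z v) (z w) (t v) (t w))
    (hα : ∀ v ∈ S, t v 1 vac = α v • vac) (u : K) (vs : List ι) (hS : ∀ v ∈ vs, v ∈ S)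
    (hvs : vs.Pairwise fun v w => z v ≠ z w) (hu : ∀ v ∈ vs, z v ≠ u) :
    offProd (fun v => dress (g c (z v) u) (t v)) (Pi.single 1 vac) vs =
      Pi.single 1 (offProd t vac vs) + Pi.single 2 (∑ j : Fin vs.length,
        (α (vs.get j) * g c (z (vs.get j)) u * exchangeCoeff c z vs j) •
          offProd t vac (vs.eraseIdx j)) := by
  induction vs with
  | nil => simp [offProd]
  | cons v vs ih =>
    rw [offProd_cons, ih (fun w hw => hS w (by simp [hw])) (List.pairwise_cons.1 hvs).2
      (fun w hw => hu w (by simp [hw]))]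
    have hA := diag_offProd ht hα v vs hS hvs
    have hsum : ∀ F : Fin (v :: vs).length → X, ∑ j, F j = F 0 + ∑ j : Fin vs.length, F j.succ :=
      fun F => Fin.sum_univ_succ (n := vs.length) F
    have e0 : exchangeCoeff c z (v :: vs) 0 = (vs.map fun w => f c (z w) (z v)).prod := rfl
    have es : ∀ j : Fin vs.length, exchangeCoeff c z (v :: vs) j.succ =
      -f c (z (vs.get j)) (z v) * exchangeCoeff c z vs j := fun j => rfl
    rw [hsum]
    simp only [e0, es, Fin.val_zero, Fin.val_succ, List.eraseIdx_cons_zero,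
      List.eraseIdx_cons_succ, List.get_cons_zero, List.get_cons_succ', offProd_cons]
    funext m
    rw [dress_apply]
    fin_cases m
    · simp [gr]
    · simp [gr]
    · simp only [Fin.sum_univ_three, Pi.add_apply, gr, Fin.reduceFinMk]
      simp only [Pi.single_apply, Fin.reduceEq, if_true, if_false, map_zero, add_zero, zero_add,
        map_sum, map_smul, mul_one, pow_one]
      rw [hA]
      simp only [smul_add, Finset.smul_sum, smul_smul]
      -- Three sources feed each e_3 term: the graded sign -1 at an already flipped site, a new flip
      -- through t_22(v), and the diagonal entry of L on e_3. By `g_mul_g` their sum has the same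
      -- factor -f(v_j,v) as in `exchangeCoeff`.
      have hj : ∀ j : Fin vs.length,
          (α (vs.get j) * g c (z (vs.get j)) u *
            (-f c (z (vs.get j)) (z v) * exchangeCoeff c z vs j)) •
              t v 2 (offProd t vac (vs.eraseIdx j)) =
          (-1 * (α (vs.get j) * g c (z (vs.get j)) u * exchangeCoeff c z vs j)) •
              t v 2 (offProd t vac (vs.eraseIdx j)) +
          ((g c (z v) u * (α (vs.get j) * g c (z v) (z (vs.get j)) * exchangeCoeff c z vs j)) •
              t v 2 (offProd t vac (vs.eraseIdx j)) +
            (g c (z v) u * (α (vs.get j) * g c (z (vs.get j)) u * exchangeCoeff c z vs j)) •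
              t v 2 (offProd t vac (vs.eraseIdx j))) := by
        intro j
        have hmem : vs.get j ∈ vs := List.get_mem _ _
        have hvm : z v ≠ z (vs.get j) := (List.pairwise_cons.1 hvs).1 _ hmem
        have hg := g_mul_g (c := c) hvm (hu v (by simp)) (hu _ (List.mem_cons_of_mem _ hmem))
        simp only [f, g_swap c (z v) (z (vs.get j))]
        linear_combination (norm := module) (-(α (vs.get j) * exchangeCoeff c z vs j) * hg) •
          t v 2 (offProd t vac (vs.eraseIdx j))
      rw [Finset.sum_congr rfl fun j _ => hj j, Finset.sum_add_distrib, Finset.sum_add_distrib]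
      module

theorem H_succ (c : K) {b : ℕ} (v : Fin (b + 1) → K) :
    H c v = (∏ j : Fin b, h c (v j.succ) (v 0)) * H c fun j => v j.succ := by
  unfold H
  rw [Fin.prod_univ_succ, ← Finset.prod_mul_distrib]
  have h0 : Finset.Iio (0 : Fin (b + 1)) = ∅ := by ext; simp
  rw [h0, Finset.prod_empty, one_mul]
  refine Finset.prod_congr rfl fun j _ => ?_
  have h1 : Finset.Iio j.succ = Finset.univ.filter fun r => r < j.succ := by ext; simp
  have h2 : Finset.Iio j = Finset.univ.filter fun r => r < j := by ext; simp
  rw [h1, h2, Finset.prod_filter, Finset.prod_filter, Fin.prod_univ_succ]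
  simp

theorem H_cons (c : K) (z : ι → K) (v : ι) (vs : List ι) :
    (H c fun j => z ((v :: vs).get j)) =
      (vs.map fun w => h c (z w) (z v)).prod * H c fun j => z (vs.get j) := by
  refine (H_succ (b := vs.length) c fun j => z ((v :: vs).get j)).trans ?_
  congr 1
  rw [← List.prod_ofFn]
  congr 1
  conv_rhs => rw [← List.ofFn_get vs, List.map_ofFn]
  rfl

theorem f_eq_g_mul_h {c x y : K} (hc : c ≠ 0) (hxy : x ≠ y) : f c x y = g c x y * h c x y := by
  have := sub_ne_zero.2 hxy
  unfold f g h
  field_simp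

/-- Writing f = g h, the h-factors of the exchange coefficient are exactly those of `H` involving
v_j, and each sign turns g(v_j,v_k) into g(v_k,v_j). The cross-multiplied form needs no nonvanishing
of h. -/
theorem exchangeCoeff_mul_H {c : K} (hc : c ≠ 0) (z : ι → K) (vs : List ι)
    (hvs : vs.Pairwise fun v w => z v ≠ z w) (j : Fin vs.length) :
    (exchangeCoeff c z vs j * H c fun k => z ((vs.eraseIdx j).get k)) =
      ((vs.eraseIdx j).map fun v => g c (z v) (z (vs.get j))).prod * H c fun k => z (vs.get k) := by
  induction vs with
  | nil => exact j.elim0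
  | cons v vs ih =>
    rw [List.pairwise_cons] at hvs
    rw [H_cons]
    induction j using Fin.cases with
    | zero =>
      show (vs.map fun w => f c (z w) (z v)).prod * _ = (vs.map fun w => g c (z w) (z v)).prod * _
      rw [← mul_assoc, ← List.prod_map_mul]
      congr 2
      exact List.map_congr_left fun w hw => f_eq_g_mul_h hc (hvs.1 w hw).symm
    | succ j =>
      have hm : z v ≠ z (vs.get j) := hvs.1 _ (List.get_mem _ _)
      have hprod : (vs.map fun w => h c (z w) (z v)).prod = h c (z (vs.get j)) (z v) *
          ((vs.eraseIdx j).map fun w => h c (z w) (z v)).prod := by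
        have hp := ((List.getElem_cons_eraseIdx_perm j.isLt).map
          fun w => h c (z w) (z v)).prod_eq
        rw [← hp, List.map_cons, List.prod_cons]
        rfl
      show -f c (z (vs.get j)) (z v) * exchangeCoeff c z vs j *
        (H c fun k => z ((v :: vs.eraseIdx j).get k)) =
          ((v :: vs.eraseIdx j).map fun w => g c (z w) (z (vs.get j))).prod * _
      rw [H_cons, hprod, f_eq_g_mul_h hc hm.symm, g_swap c (z v), List.map_cons, List.prod_cons]
      linear_combination (g c (z v) (z (vs.get j)) * h c (z (vs.get j)) (z v) *
        ((vs.eraseIdx j).map fun w => h c (z w) (z v)).prod) * ih hvs.2 j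

end BetheAnsatz

/-! ### Spin-chain realisation and the recursion over a general field -/

section BetheVectors

universe uW

variable {K : Type*} [Field K] {ι : Type*} {W : Type uW} [AddCommGroup W] [Module K W]

/-- The module is `W` with one three-dimensional site for each u_k, the vacuum is Ω with every site
in e_2, and `φ` contracts the sites with T_{1m_1}(u_1) ⋯ T_{1m_a}(u_a). On e_2 the diagonal entry of
L is 1 + g = f, which accounts for the eigenvalue. -/
theorem exists_dressed_module (c : K) (z : ι → K) (T : ι → Fin 3 → Fin 3 → Module.End K W) (Ω : W)
    (α : ι → K) (S : Set ι) (hT : ∀ v ∈ S, ∀ w ∈ S, z v ≠ z w → RTT c (z v) (z w) (T v) (T w))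
    (hα : ∀ v ∈ S, T v 1 1 Ω = α v • Ω) (us : List ι) (hus : ∀ v ∈ S, ∀ u ∈ us, z v ≠ z u) :
    ∃ (X : Type uW) (_ : AddCommGroup X) (_ : Module K X) (t : ι → Fin 3 → Module.End K X) (vac : X)
      (φ : X →ₗ[K] W),
      (∀ v ∈ S, ∀ w ∈ S, z v ≠ z w → RowRTT c (z v) (z w) (t v) (t w)) ∧
      (∀ v ∈ S, t v 1 vac = (α v * (us.map fun u => f c (z v) (z u)).prod) • vac) ∧
      ∀ {b : ℕ} (v : Fin b → ι) (l : Fin b → Fin 3),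
        dressedRow c z T Ω us.get v l = φ ((List.ofFn fun j => t (v j) (l j)).prod vac) := by
  induction us with
  | nil =>
    refine ⟨W, inferInstance, inferInstance, fun v => T v 1, Ω, LinearMap.id,
      fun v hv w hw hvw => (hT v hv w hw hvw).rowRTT, fun v hv => by simp [hα v hv], ?_⟩
    intro b v l
    have hR : RR c (fun k => z (([] : List ι).get k)) (fun j => z (v j)) = 1 := by
      refine List.prod_eq_one fun M hM => ?_
      obtain ⟨j, -, rfl⟩ := List.mem_map.1 hM
      rfl
    rw [dressedRow, hR, rowAct_one, monodromyRow]
    simp only [Fin.append_right]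
    rfl
  | cons u us ih =>
    obtain ⟨X, _, _, t, vac, φ, h1, h2, h3⟩ := ih fun v hv u hu => hus v hv u (by simp [hu])
    have hu : ∀ v ∈ S, z v ≠ z u := fun v hv => hus v hv u (by simp)
    refine ⟨Fin 3 → X, inferInstance, inferInstance, fun v => dress (g c (z v) (z u)) (t v),
      Pi.single 1 vac, ∑ m, T u 0 m ∘ₗ φ ∘ₗ LinearMap.proj m, ?_, ?_, ?_⟩
    · intro v hv w hw hvw
      exact RowRTT.dress hvw (hu v hv) (hu w hw) (h1 v hv w hw hvw) (h1 w hw v hv hvw.symm)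
    · intro v hv
      funext m
      rw [dress_apply]
      fin_cases m
      · simp [gr]
      · simp [gr, Fin.sum_univ_three, h2 v hv, f]
        module
      · simp [gr]
    · intro b v l
      refine (dressedRow_succ (a := us.length) c z T Ω (u :: us).get v l).trans ?_
      have h4 : ∀ l, dressedRow c z T Ω (fun k : Fin us.length => (u :: us).get k.succ) v l =
          φ ((List.ofFn fun j => t (v j) (l j)).prod vac) := fun l => h3 v l
      have h5 := foldl_siteAct (fun j => g c (z (v j)) (z u)) (fun j => t (v j))
        (fun n => T u 0 n ∘ₗ φ) vac 1 l
      simp only [h4]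
      refine h5.trans ?_
      simp [gr]

/-- The chain is built on `us` only, so its vacuum eigenvalue carries the product f(v_j, ū_1). The
site of u_1 is added explicitly, and its states e_2 and e_3 select T_12 and T_13. -/
theorem Φ_cons (c : K) (hc : c ≠ 0) (z : ι → K) (T : ι → Fin 3 → Fin 3 → Module.End K W) (Ω : W)
    (α : ι → K) (u₁ : ι) (us vs : List ι)
    (hT : ∀ v ∈ vs, ∀ w ∈ vs, z v ≠ z w → RTT c (z v) (z w) (T v) (T w))
    (hα : ∀ v ∈ vs, T v 1 1 Ω = α v • Ω) (hvs : vs.Pairwise fun v w => z v ≠ z w)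
    (hus : ∀ v ∈ vs, ∀ u ∈ u₁ :: us, z v ≠ z u)
    (hh : ∀ v ∈ vs, ∀ w ∈ vs, z v ≠ z w → h c (z v) (z w) ≠ 0) :
    Φ c z T Ω (u₁ :: us) vs = T u₁ 0 1 (Φ c z T Ω us vs) +
      ∑ j : Fin vs.length,
        (α (vs.get j) * g c (z (vs.get j)) (z u₁)
          * (us.map fun u => f c (z (vs.get j)) (z u)).prod
          * ((vs.eraseIdx j).map fun v => g c (z v) (z (vs.get j))).prod) •
          T u₁ 0 2 (Φ c z T Ω us (vs.eraseIdx j)) := by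
  obtain ⟨X, _, _, t, vac, φ, h1, h2, h3⟩ := exists_dressed_module c z T Ω α {v | v ∈ vs} hT hα us
    fun v hv u hu => hus v hv u (by simp [hu])
  have hΦ : ∀ ws : List ι, Φ c z T Ω us ws =
      (H c fun j => z (ws.get j))⁻¹ • φ (offProd t vac ws) := by
    intro ws
    rw [Φ_eq_dressedRow, h3, offProd]
    congr 4
    conv_rhs => rw [← List.ofFn_get ws, List.map_ofFn]
    rfl
  have hΦ' : Φ c z T Ω (u₁ :: us) vs = (H c fun j => z (vs.get j))⁻¹ •
      ∑ m, T u₁ 0 m (φ (offProd (fun v => dress (g c (z v) (z u₁)) (t v)) (Pi.single 1 vac) vs m)) := by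
    rw [Φ_eq_dressedRow]
    congr 1
    refine (dressedRow_succ (a := us.length) c z T Ω (u₁ :: us).get vs.get _).trans ?_
    have h4 : ∀ l, dressedRow c z T Ω (fun k : Fin us.length => (u₁ :: us).get k.succ) vs.get l =
        φ ((List.ofFn fun j => t (vs.get j) (l j)).prod vac) := fun l => h3 vs.get l
    have h5 := foldl_siteAct (fun j => g c (z (vs.get j)) (z u₁)) (fun j => t (vs.get j))
      (fun n => T u₁ 0 n ∘ₗ φ) vac 1 (fun _ => 2)
    simp only [h4]
    refine h5.trans ?_
    have h6 : (List.ofFn fun j => dress (g c (z (vs.get j)) (z u₁)) (t (vs.get j)) 2) =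
        vs.map fun v => dress (g c (z v) (z u₁)) (t v) 2 := by
      conv_rhs => rw [← List.ofFn_get vs, List.map_ofFn]
      rfl
    rw [h6]
    simp [gr, offProd]
  have hH : ∀ ws : List ι, ws.Sublist vs → (H c fun j => z (ws.get j)) ≠ 0 := by
    intro ws hws
    refine Finset.prod_ne_zero_iff.2 fun j _ => Finset.prod_ne_zero_iff.2 fun k hk => ?_
    refine hh _ (hws.subset (List.get_mem _ _)) _ (hws.subset (List.get_mem _ _)) ?_
    exact (List.pairwise_iff_get.1 (hvs.sublist hws) k j (Finset.mem_Iio.1 hk)).symm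
  rw [hΦ', dress_offProd h1 h2 (z u₁) vs (fun v hv => hv) hvs
    (fun v hv => hus v hv u₁ (by simp)), hΦ vs]
  simp only [hΦ, Fin.sum_univ_three, Pi.add_apply]
  simp only [Pi.single_apply, Fin.reduceEq, if_true, if_false, map_zero, add_zero, zero_add,
    map_sum, map_smul, smul_add, Finset.smul_sum, smul_smul]
  congr 1
  refine Finset.sum_congr rfl fun j _ => ?_
  congr 1
  have hc1 := exchangeCoeff_mul_H hc z vs hvs j
  have hH1 := hH vs (List.Sublist.refl _)
  have hH2 := hH (vs.eraseIdx j) (List.eraseIdx_sublist _ _)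
  set A := exchangeCoeff c z vs j
  set B := ((vs.eraseIdx j).map fun v => g c (z v) (z (vs.get j))).prod
  set H1 := H c fun j => z (vs.get j)
  set H2 := H c fun k => z ((vs.eraseIdx j).get k)
  have hAB : H1⁻¹ * A = B * H2⁻¹ := by
    field_simp
    linear_combination hc1
  linear_combination (α (vs.get j) * g c (z (vs.get j)) (z u₁) *
    (us.map fun u => f c (z (vs.get j)) (z u)).prod) * hAB

end BetheVectors

/-! ### The RTT relation for generating series -/

section FormalSeries

variable {σ A : Type*} [Ring A]

open Classical in
/-- The series with coefficient `t p q` at `x_s^p x_{s'}^q`. -/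
def doubleSeries (s s' : σ) (t : ℕ → ℕ → A) : MvPowerSeries σ A :=
  fun n => if ∀ x, x ≠ s → x ≠ s' → n x = 0 then t (n s) (n s') else 0

theorem coeff_doubleSeries_of_forall {s s' : σ} (t : ℕ → ℕ → A) {n : σ →₀ ℕ}
    (hn : ∀ x, x ≠ s → x ≠ s' → n x = 0) :
    MvPowerSeries.coeff n (doubleSeries s s' t) = t (n s) (n s') := if_pos hn

theorem coeff_doubleSeries_of_not_forall {s s' : σ} (t : ℕ → ℕ → A) {n : σ →₀ ℕ}
    (hn : ¬ ∀ x, x ≠ s → x ≠ s' → n x = 0) :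
    MvPowerSeries.coeff n (doubleSeries s s' t) = 0 := if_neg hn

theorem doubleSeries_swap (s s' : σ) (t : ℕ → ℕ → A) :
    doubleSeries s' s t = doubleSeries s s' fun p q => t q p := by
  ext1 n
  by_cases hn : ∀ x, x ≠ s → x ≠ s' → n x = 0
  · rw [coeff_doubleSeries_of_forall _ hn, coeff_doubleSeries_of_forall _ fun x h h' => hn x h' h]
  · rw [coeff_doubleSeries_of_not_forall _ hn,
      coeff_doubleSeries_of_not_forall _ fun h => hn fun x h1 h2 => h x h2 h1]

theorem doubleSeries_sub (s s' : σ) (t t' : ℕ → ℕ → A) :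
    doubleSeries s s' t - doubleSeries s s' t' = doubleSeries s s' fun p q => t p q - t' p q := by
  ext1 n
  rw [map_sub]
  by_cases hn : ∀ x, x ≠ s → x ≠ s' → n x = 0
  · simp only [coeff_doubleSeries_of_forall _ hn]
  · simp only [coeff_doubleSeries_of_not_forall _ hn, sub_zero]

theorem C_mul_doubleSeries (s s' : σ) (a : A) (t : ℕ → ℕ → A) :
    MvPowerSeries.C a * doubleSeries s s' t = doubleSeries s s' fun p q => a * t p q := by
  ext1 n
  rw [MvPowerSeries.coeff_C_mul]
  by_cases hn : ∀ x, x ≠ s → x ≠ s' → n x = 0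
  · simp only [coeff_doubleSeries_of_forall _ hn]
  · simp only [coeff_doubleSeries_of_not_forall _ hn, mul_zero]

theorem X_mul_doubleSeries {s s' : σ} (hs : s ≠ s') (t : ℕ → ℕ → A) :
    MvPowerSeries.X s * doubleSeries s s' t =
      doubleSeries s s' fun p q => if p = 0 then 0 else t (p - 1) q := by
  classical
  ext1 n
  rw [MvPowerSeries.X, MvPowerSeries.coeff_monomial_mul, one_mul]
  have hle : Finsupp.single s 1 ≤ n ↔ n s ≠ 0 := by
    rw [Finsupp.single_le_iff]
    omega
  have hx : ∀ x, x ≠ s → (n - Finsupp.single s 1 : σ →₀ ℕ) x = n x := by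
    intro x hx
    simp [Finsupp.tsub_apply, hx.symm]
  have hss : (n - Finsupp.single s 1 : σ →₀ ℕ) s = n s - 1 := by simp [Finsupp.tsub_apply]
  by_cases hn : ∀ x, x ≠ s → x ≠ s' → n x = 0
  · have hn' : ∀ x, x ≠ s → x ≠ s' → (n - Finsupp.single s 1 : σ →₀ ℕ) x = 0 := fun x h1 h2 => by
      rw [hx x h1, hn x h1 h2]
    rw [coeff_doubleSeries_of_forall _ hn, coeff_doubleSeries_of_forall _ hn', hss, hx s' hs.symm]
    by_cases h0 : n s = 0
    · rw [if_neg (by simp [hle, h0]), if_pos h0]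
    · rw [if_pos (hle.2 h0), if_neg h0]
  · rw [coeff_doubleSeries_of_not_forall _ hn]
    split_ifs
    · refine coeff_doubleSeries_of_not_forall _ fun h => hn fun x h1 h2 => ?_
      rw [← hx x h1, h x h1 h2]
    · rfl

theorem X_mul_doubleSeries' {s s' : σ} (hs : s ≠ s') (t : ℕ → ℕ → A) :
    MvPowerSeries.X s' * doubleSeries s s' t =
      doubleSeries s s' fun p q => if q = 0 then 0 else t p (q - 1) := by
  rw [doubleSeries_swap s' s, X_mul_doubleSeries hs.symm, doubleSeries_swap s s']

variable [Algebra ℂ A]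

open Classical in
theorem coeff_genSeries (c : ℂ) (t : ℕ → A) (s : σ) (n : σ →₀ ℕ) :
    MvPowerSeries.coeff n (genSeries c t s) =
      if n = Finsupp.single s (n s) then c ^ n s • t (n s) else 0 := rfl

theorem genSeries_mul {s s' : σ} (hs : s ≠ s') (c : ℂ) (t t' : ℕ → A) :
    genSeries c t s * genSeries c t' s' =
      doubleSeries s s' fun p q => c ^ (p + q) • (t p * t' q) := by
  classical
  ext1 n
  rw [MvPowerSeries.coeff_mul]
  have hzero : ∀ p q : σ →₀ ℕ, p + q = n →
      (p ≠ Finsupp.single s (n s) ∨ q ≠ Finsupp.single s' (n s')) →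
      MvPowerSeries.coeff p (genSeries c t s) * MvPowerSeries.coeff q (genSeries c t' s') = 0 := by
    intro p q hpq hne
    rw [coeff_genSeries, coeff_genSeries]
    by_cases hp : p = Finsupp.single s (p s)
    swap
    · rw [if_neg hp, zero_mul]
    by_cases hq : q = Finsupp.single s' (q s')
    swap
    · rw [if_neg hq, mul_zero]
    exfalso
    have h1 : n s = p s := by
      rw [← hpq, Finsupp.add_apply, hq, Finsupp.single_eq_of_ne hs, add_zero]
    have h2 : n s' = q s' := by
      rw [← hpq, Finsupp.add_apply, hp, Finsupp.single_eq_of_ne hs.symm, zero_add]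
    rw [h1, h2] at hne
    tauto
  by_cases hn : ∀ x, x ≠ s → x ≠ s' → n x = 0
  · have hsum : Finsupp.single s (n s) + Finsupp.single s' (n s') = n := by
      ext x
      by_cases h1 : x = s
      · subst h1
        simp [hs]
      by_cases h2 : x = s'
      · subst h2
        simp [hs.symm]
      simp [hn x h1 h2, h1, h2]
    rw [coeff_doubleSeries_of_forall _ hn,
      Finset.sum_eq_single (Finsupp.single s (n s), Finsupp.single s' (n s'))]
    · rw [coeff_genSeries, coeff_genSeries]
      simp only [Finsupp.single_eq_same, if_true]
      rw [smul_mul_smul_comm, pow_add]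
    · rintro ⟨p, q⟩ hpq hne
      refine hzero p q (Finset.HasAntidiagonal.mem_antidiagonal.1 hpq) ?_
      rw [Ne, Prod.mk.injEq] at hne
      tauto
    · intro h
      exact absurd (Finset.HasAntidiagonal.mem_antidiagonal.2 hsum) h
  · rw [coeff_doubleSeries_of_not_forall _ hn]
    refine Finset.sum_eq_zero fun ⟨p, q⟩ hpq => ?_
    have hpq' := Finset.HasAntidiagonal.mem_antidiagonal.1 hpq
    refine hzero p q hpq' ?_
    by_contra hcon
    push Not at hcon
    refine hn fun x h1 h2 => ?_
    rw [← hpq', hcon.1, hcon.2]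
    simp [h1, h2]

theorem genSeries_mul' {s s' : σ} (hs : s ≠ s') (c : ℂ) (t t' : ℕ → A) :
    genSeries c t' s' * genSeries c t s =
      doubleSeries s s' fun p q => c ^ (p + q) • (t' q * t p) := by
  rw [genSeries_mul hs.symm, doubleSeries_swap s s']
  simp only [add_comm]

theorem coeffT_zero (i j : Fin 3) : coeffT i j 0 = if i = j then 1 else 0 := by
  rw [coeffT, freeCoeff]
  split_ifs <;> simp

theorem coeffT_rtt (i j k l : Fin 3) (r s : ℕ) :
    ((coeffT i j (r + 1) * coeffT k l s
        - (-1) ^ ((gr i + gr j) * (gr k + gr l)) * (coeffT k l s * coeffT i j (r + 1)))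
      - (coeffT i j r * coeffT k l (s + 1)
        - (-1) ^ ((gr i + gr j) * (gr k + gr l)) * (coeffT k l (s + 1) * coeffT i j r))) =
      (-1) ^ (gr l * (gr i + gr j) + gr i * gr j) *
        (coeffT i l r * coeffT k j s - coeffT i l s * coeffT k j r) := by
  have h := RingQuot.mkAlgHom_rel ℂ (Rel.rtt i j k l r s)
  simp only [map_sub, map_mul, map_pow, map_neg, map_one] at h
  exact h

/-- With z = 1/x_s and w = 1/x_{s'}, one has z - w = (x_{s'} - x_s)/(x_s x_{s'}). Clearing
denominators leaves a power series identity that can be checked coefficientwise. -/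
theorem genSeries_rtt (c : ℂ) (ρ : Yangian →ₐ[ℂ] A) {s s' : σ} (hs : s ≠ s') (i j k l : Fin 3) :
    (MvPowerSeries.X s' - MvPowerSeries.X s) *
        (genSeries c (fun r => ρ (coeffT i j r)) s * genSeries c (fun r => ρ (coeffT k l r)) s'
          - (-1) ^ ((gr i + gr j) * (gr k + gr l)) *
            (genSeries c (fun r => ρ (coeffT k l r)) s' *
              genSeries c (fun r => ρ (coeffT i j r)) s)) =
      MvPowerSeries.C (algebraMap ℂ A c) * (MvPowerSeries.X s * (MvPowerSeries.X s' *
        ((-1) ^ (gr l * (gr i + gr j) + gr i * gr j) *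
          (genSeries c (fun r => ρ (coeffT i l r)) s * genSeries c (fun r => ρ (coeffT k j r)) s'
            - genSeries c (fun r => ρ (coeffT i l r)) s' *
              genSeries c (fun r => ρ (coeffT k j r)) s)))) := by
  have hsign : ∀ e : ℕ, (-1 : MvPowerSeries σ A) ^ e = MvPowerSeries.C ((-1) ^ e) := by
    intro e
    rw [map_pow, map_neg, map_one]
  rw [hsign, hsign, genSeries_mul hs, genSeries_mul' hs, genSeries_mul hs, genSeries_mul' hs,
    C_mul_doubleSeries, doubleSeries_sub, doubleSeries_sub, C_mul_doubleSeries, sub_mul,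
    X_mul_doubleSeries hs, X_mul_doubleSeries' hs, X_mul_doubleSeries' hs, X_mul_doubleSeries hs,
    C_mul_doubleSeries, doubleSeries_sub]
  congr 1
  funext p q
  have hrtt := fun p q => congrArg ρ (coeffT_rtt i j k l p q)
  simp only [map_sub, map_mul, map_pow, map_neg, map_one] at hrtt
  have hs' : ∀ (e : ℕ) (a : ℂ) (b : A), (-1) ^ e * a • b = a • ((-1) ^ e * b) := fun e a b =>
    mul_smul_comm _ _ _
  -- On the boundary p = 0 or q = 0 no defining relation is available. There the commutator involves
  -- the scalar leading coefficient δ and vanishes, the sign being trivial when the indices agree.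
  have hi0 : ∀ q, ρ (coeffT i j 0) * ρ (coeffT k l q) -
      (-1) ^ ((gr i + gr j) * (gr k + gr l)) * (ρ (coeffT k l q) * ρ (coeffT i j 0)) = 0 := by
    intro q
    rw [coeffT_zero]
    split_ifs with h
    · subst h
      rw [← two_mul, mul_assoc, pow_mul]
      simp
    · simp
  have hk0 : ∀ p, ρ (coeffT i j p) * ρ (coeffT k l 0) -
      (-1) ^ ((gr i + gr j) * (gr k + gr l)) * (ρ (coeffT k l 0) * ρ (coeffT i j p)) = 0 := by
    intro p
    rw [coeffT_zero]
    split_ifs with h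
    · subst h
      rw [← two_mul, mul_left_comm, pow_mul]
      simp
    · simp
  simp only [hs', ← smul_sub]
  rcases p with _ | p <;> rcases q with _ | q
  · simp
  · simp [hi0]
  · simp [hk0]
  · simp only [Nat.add_eq_zero_iff, one_ne_zero, and_false, if_false, Nat.add_sub_cancel]
    rw [show p + (q + 1) = p + q + 1 by ring, show p + 1 + q = p + q + 1 by ring, ← smul_sub,
      hrtt, ← Algebra.smul_def, smul_smul, ← pow_succ']

end FormalSeries

/-! ### Operators over the fraction field -/

section FormalOperators

theorem eq_g_smul_of_sub_mul_eq {K W : Type*} [Field K] [AddCommGroup W] [Module K W] {c x x' : K}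
    (hx : x ≠ 0) (hx' : x' ≠ 0) (hxx : x' - x ≠ 0) {A B : Module.End K W} {e : ℕ}
    (hAB : (x' • 1 - x • 1) * A = c • 1 * (x • 1 * (x' • 1 * ((-1) ^ e * B)))) :
    A = ((-1) ^ e * g c x⁻¹ x'⁻¹) • B := by
  rw [← sub_smul, smul_one_mul, smul_one_mul, smul_one_mul, smul_one_mul, neg_one_pow_mul_eq_smul,
    smul_smul, smul_smul, smul_smul] at hAB
  refine smul_right_injective _ hxx (hAB.trans ?_)
  simp only [smul_smul]
  rw [g, inv_sub_inv hx hx']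
  congr 1
  field_simp

variable {σ V : Type*} [AddCommGroup V] [Module ℂ V]

variable (σ V) in
/-- Power series of operators on `V`, as operators on `V[[x_s : s ∈ σ]]` with extended scalars. -/
def formalOp : MvPowerSeries σ (Module.End ℂ V) →+* Module.End (Scal σ) (Vec σ V) :=
  ((Module.End.baseChangeHom (MvPowerSeries σ ℂ) (Scal σ) (VecSeries σ V)) :
      Module.End (MvPowerSeries σ ℂ) (VecSeries σ V) →+* Module.End (Scal σ) (Vec σ V)).comp
    { toFun := seriesOp
      map_one' := LinearMap.ext fun w => one_smul _ w
      map_mul' := fun F G => LinearMap.ext fun w => mul_smul F G w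
      map_zero' := LinearMap.ext fun w => zero_smul _ w
      map_add' := fun F G => LinearMap.ext fun w => add_smul F G w }

theorem formalT_eq_formalOp (c : ℂ) (ρ : Yangian →ₐ[ℂ] Module.End ℂ V) (s : σ) (i j : Fin 3) :
    formalT c ρ s i j = formalOp σ V (genSeries c (fun r => ρ (coeffT i j r)) s) := rfl

theorem formalOp_map (a : MvPowerSeries σ ℂ) :
    formalOp σ V (MvPowerSeries.map (algebraMap ℂ (Module.End ℂ V)) a) =
      algebraMap (MvPowerSeries σ ℂ) (Scal σ) a • 1 := by
  have h : seriesOp (MvPowerSeries.map (algebraMap ℂ (Module.End ℂ V)) a) =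
      a • (1 : Module.End (MvPowerSeries σ ℂ) (VecSeries σ V)) := by
    refine LinearMap.ext fun w => ?_
    show MvPowerSeries.map (algebraMap ℂ (Module.End ℂ V)) a • w = a • w
    funext n
    simp [VecSeries.smul_apply]
  show (seriesOp _).baseChange (Scal σ) = _
  rw [h, LinearMap.baseChange_smul, algebraMap_smul]
  congr 1
  exact LinearMap.baseChange_id

theorem algebraMap_X_ne_zero (s : σ) :
    algebraMap (MvPowerSeries σ ℂ) (Scal σ) (MvPowerSeries.X s) ≠ 0 := by
  classical
  rw [Ne, FaithfulSMul.algebraMap_eq_zero_iff]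
  intro h
  simpa [MvPowerSeries.coeff_X] using congrArg (MvPowerSeries.coeff (Finsupp.single s 1)) h

theorem param_ne_param {s s' : σ} (hs : s ≠ s') : param s ≠ param s' := fun h =>
  hs (MvPowerSeries.X_inj.1 (FaithfulSMul.algebraMap_injective _ _ (inv_injective h)))

theorem h_param_ne_zero {c : ℂ} (hc : c ≠ 0) {s s' : σ} (hs : s ≠ s') :
    h (algebraMap ℂ (Scal σ) c) (param s) (param s') ≠ 0 := by
  classical
  have hc' : algebraMap ℂ (Scal σ) c ≠ 0 := by simpa using hc
  have hx := algebraMap_X_ne_zero s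
  have hx' := algebraMap_X_ne_zero s'
  have hser : (MvPowerSeries.X s' - MvPowerSeries.X s +
      MvPowerSeries.C c * (MvPowerSeries.X s * MvPowerSeries.X s') : MvPowerSeries σ ℂ) ≠ 0 := by
    intro h
    -- The numerator of h, cleared of denominators, has coefficient 1 at x_{s'}.
    have h1 := congrArg (MvPowerSeries.coeff (Finsupp.single s' 1)) h
    rw [map_add, map_sub, MvPowerSeries.coeff_X, MvPowerSeries.coeff_X,
      MvPowerSeries.coeff_C_mul, MvPowerSeries.X, MvPowerSeries.coeff_monomial_mul,
      if_pos rfl, if_neg, if_neg] at h1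
    · simp at h1
    · simp [Finsupp.single_le_iff, hs]
    · simp [Finsupp.single_left_inj, hs.symm]
  have hmap := (FaithfulSMul.algebraMap_eq_zero_iff (MvPowerSeries σ ℂ) (Scal σ)).not.2 hser
  rw [map_add, map_sub, map_mul, map_mul, show MvPowerSeries.C c =
    algebraMap ℂ (MvPowerSeries σ ℂ) c from rfl, ← IsScalarTower.algebraMap_apply] at hmap
  unfold h param
  refine div_ne_zero (fun h0 => hmap ?_) hc'
  field_simp at h0
  linear_combination h0

theorem formalT_rtt (c : ℂ) (ρ : Yangian →ₐ[ℂ] Module.End ℂ V) {s s' : σ} (hs : s ≠ s') :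
    RTT (algebraMap ℂ (Scal σ) c) (param s) (param s') (formalT c ρ s) (formalT c ρ s') := by
  intro i j k l
  have h := congrArg (formalOp σ V) (genSeries_rtt c ρ hs i j k l)
  have hX : ∀ s : σ, formalOp σ V (MvPowerSeries.X s) =
      algebraMap (MvPowerSeries σ ℂ) (Scal σ) (MvPowerSeries.X s) • 1 := fun s => by
    rw [← formalOp_map, MvPowerSeries.map_X]
  have hC : formalOp σ V (MvPowerSeries.C (algebraMap ℂ _ c)) = algebraMap ℂ (Scal σ) c • 1 := by
    rw [← MvPowerSeries.map_C, formalOp_map, IsScalarTower.algebraMap_apply ℂ (MvPowerSeries σ ℂ)]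
    rfl
  simp only [map_mul, map_sub, map_pow, map_neg, map_one, hX, hC, ← formalT_eq_formalOp] at h
  have hx := algebraMap_X_ne_zero s
  have hx' := algebraMap_X_ne_zero s'
  have hxx : algebraMap (MvPowerSeries σ ℂ) (Scal σ) (MvPowerSeries.X s') -
      algebraMap (MvPowerSeries σ ℂ) (Scal σ) (MvPowerSeries.X s) ≠ 0 := by
    rw [← inv_inv (algebraMap (MvPowerSeries σ ℂ) (Scal σ) (MvPowerSeries.X s')),
      ← inv_inv (algebraMap (MvPowerSeries σ ℂ) (Scal σ) (MvPowerSeries.X s))]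
    exact sub_ne_zero.2 fun h => param_ne_param hs (inv_injective h).symm
  exact eq_g_smul_of_sub_mul_eq hx hx' hxx h

/-- Against a constant series only the term with zero exponent on the vector side survives in the
Cauchy product, so the mode eigenvalues assemble into the weight series. -/
theorem formalT_constVec (c : ℂ) (ρ : Yangian →ₐ[ℂ] Module.End ℂ V) (l : ℕ → ℂ) (Ω : V) (i : Fin 3)
    (hl : ∀ p, ρ (modeT i i p) Ω = l p • Ω) (s : σ) :
    formalT c ρ s i i (constVec σ Ω) = formalWeight c l s • constVec σ Ω := by
  classical
  have h0 : ρ (coeffT i i 0) Ω = Ω := by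
    rw [coeffT_zero]
    simp
  have hw : ∀ w : VecSeries σ V, (∀ n, n ≠ 0 → w n = 0) → w 0 = Ω →
      genSeries c (fun r => ρ (coeffT i i r)) s • w =
        (genSeries c (fun r => match r with | 0 => 1 | p + 1 => l p) s : MvPowerSeries σ ℂ) • w := by
    intro w hw hw0
    funext n
    rw [VecSeries.smul_apply, VecSeries.smul_apply]
    refine Finset.sum_congr rfl fun p _ => ?_
    by_cases hp : p.2 = 0
    swap
    · rw [hw _ hp, smul_zero, smul_zero]
    rw [hp, hw0]
    rw [coeff_genSeries, coeff_genSeries]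
    split_ifs
    · rcases p.1 s with _ | r
      · simp [h0]
      · have := hl r
        rw [modeT] at this
        simp [this, mul_smul]
    · simp
  refine (LinearMap.baseChange_tmul _ _ _).trans ?_
  rw [constVec, formalWeight, algebraMap_smul]
  refine Eq.trans ?_ (TensorProduct.tmul_smul _ _ _)
  exact congrArg _ (hw _ (fun n hn => if_neg hn) (if_pos rfl))

end FormalOperators

end SuperYangian

end

open SuperYangian in
theorem mainTheorem2 (c : ℂ) (hc : c ≠ 0) {V : Type*} [AddCommGroup V] [Module ℂ V] (Ω : V) :
    -- (i) representations of `Y(2|1)`, with formal spectral parameters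
    (∀ {σ : Type*} (ρ : Yangian →ₐ[ℂ] Module.End ℂ V) (lam : Fin 3 → ℕ → ℂ),
      (∀ i p, ρ (modeT i i p) Ω = lam i p • Ω) →
      (∀ i j p, j < i → ρ (modeT i j p) Ω = 0) →
      ∀ (u₁ : σ) (us vs : List σ), vs.Nodup → (∀ u ∈ u₁ :: us, u ∉ vs) →
      formalΦ c ρ Ω (u₁ :: us) vs =
        formalT c ρ u₁ 0 1 (formalΦ c ρ Ω us vs) +
          ∑ j : Fin vs.length,
            (formalWeight c (lam 1) (vs.get j)
              * g (algebraMap ℂ (Scal σ) c) (param (vs.get j)) (param u₁)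
              * (us.map fun u => f (algebraMap ℂ (Scal σ) c) (param (vs.get j)) (param u)).prod
              * ((vs.eraseIdx j).map fun v =>
                  g (algebraMap ℂ (Scal σ) c) (param v) (param (vs.get j))).prod) •
              formalT c ρ u₁ 0 2 (formalΦ c ρ Ω us (vs.eraseIdx j))) ∧
    -- (ii) operators `T_{ij}(u)` depending on complex spectral parameters `u ∈ D`
    (∀ (D : Set ℂ) (T : ℂ → Fin 3 → Fin 3 → Module.End ℂ V) (lam : Fin 3 → ℂ → ℂ),
      (∀ z ∈ D, ∀ w ∈ D, z ≠ w → RTT c z w (T z) (T w)) →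
      (∀ i, ∀ z ∈ D, T z i i Ω = lam i z • Ω) →
      (∀ i j, ∀ z ∈ D, j < i → T z i j Ω = 0) →
      ∀ (u₁ : ℂ) (us vs : List ℂ), (∀ z ∈ u₁ :: us, z ∈ D) → (∀ z ∈ vs, z ∈ D) →
      vs.Nodup → (∀ u ∈ u₁ :: us, u ∉ vs) → (∀ v ∈ vs, ∀ w ∈ vs, h c v w ≠ 0) →
      Φ c id T Ω (u₁ :: us) vs =
        T u₁ 0 1 (Φ c id T Ω us vs) +
          ∑ j : Fin vs.length,
            (lam 1 (vs.get j) * g c (vs.get j) u₁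
              * (us.map fun u => f c (vs.get j) u).prod
              * ((vs.eraseIdx j).map fun v => g c v (vs.get j)).prod) •
              T u₁ 0 2 (Φ c id T Ω us (vs.eraseIdx j))) := by
  refine ⟨?_, ?_⟩
  · intro σ ρ lam hdiag _ u₁ us vs hvs hus
    have hc' : algebraMap ℂ (Scal σ) c ≠ 0 := by simpa using hc
    refine Φ_cons _ hc' param (formalT c ρ) (constVec σ Ω) (fun s => formalWeight c (lam 1) s)
      u₁ us vs ?_ ?_ ?_ ?_ ?_
    · exact fun v _ w _ hvw => formalT_rtt c ρ fun h => hvw (congrArg param h)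
    · exact fun v _ => formalT_constVec c ρ (lam 1) Ω 1 (hdiag 1) v
    · exact hvs.imp fun h => param_ne_param h
    · exact fun v hv u hu => param_ne_param fun h => hus u hu (h ▸ hv)
    · exact fun v _ w _ hvw => h_param_ne_zero hc fun h => hvw (congrArg param h)
  · intro D T lam hT hdiag _ u₁ us vs _ hvD hvs hus hh
    refine Φ_cons c hc id T Ω (lam 1) u₁ us vs ?_ ?_ ?_ ?_ ?_
    · exact fun v hv w hw hvw => hT v (hvD v hv) w (hvD w hw) hvw
    · exact fun v hv => hdiag 1 v (hvD v hv)
    · exact hvs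
    · exact fun v hv u hu h => hus u hu ((show v = u from h) ▸ hv)
    · exact fun v hv w hw _ => hh v hv w hw
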